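/- Let $\mathbb{T}$ be a coherent theory over a small, many-sorted, finitary signature $\Sigma$. Models are set-based, with carriers allowed to be empty; morphisms of models are arbitrary homomorphisms of $\Sigma$-structures; a coherent formula is built from atomic formulas (including equalities) with $\top,\wedge,\bot,\vee,\exists$. All theories $\mathbb{T}'$ below are coherent theories over $\Sigma$. Definitions. * For coherent formulas $\varphi,\psi$ in a finite context $x$, $\psi$ is a (coherent) pseudo-complement of $\varphi$, written $\psi=\varphi^*$, if for every coherent formula $\chi$ in context $x$, the sequent $\chi\vdash_x\psi$ is provable in $\mathbb{T}$ (in coherent logic) if and only if $\varphi\wedge\chi\vdash_x\bot$ is. $\mathbb{T}$ *satisfies De Morgan's law for coherent formulas* if for every finite context $x$ and every coherent formula $\varphi$ in context $x$, $\varphi^*$ and $\varphi^{**}$ exist and $\mathbb{T}$ proves $\top\vdash_x\varphi^*\vee\varphi^{**}$. * $\mathbb{T}'$ is *model consistent relative to* $\mathbb{T}$ if every model of $\mathbb{T}$ has a homomorphism to a model of $\mathbb{T}'$. * A coherent formula $\varphi$ is *strongly invariant in* $(\mathbb{T}'\text{-Mod},\mathbb{T}\text{-Mod})$ if for every model $M$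 of $\mathbb{T}$, all models $M_1,M_2$ of $\mathbb{T}'$, all homomorphisms $h_i:M\to M_i$ and every tuple $a$ in $M$ of the sorts of the context of $\varphi$, $M_1\models\varphi(h_1(a))$ iff $M_2\models\varphi(h_2(a))$. $\mathbb{T}'$ is *model complete relative to* $\mathbb{T}$ if every coherent formula has this property, and *model complete* if it is model complete relative to itself. * $\mathbb{T}'$ is a *model companion* of $\mathbb{T}$ if $\mathbb{T}$ and $\mathbb{T}'$ are model consistent relative to each other and $\mathbb{T}'$ is model complete. $\mathbb{T}'$ is a *model completion* of $\mathbb{T}$ if $\mathbb{T}'$ proves every axiom of $\mathbb{T}$ and $\mathbb{T}'$ is model consistent and model complete relative to $\mathbb{T}$. * A model $M$ of $\mathbb{T}$ is *existentially closed* if for every homomorphism $h:M\to N$ to a model $N$ of $\mathbb{T}$, every coherent $\varphi$ and every tuple $a$ in $M$, $M\models\varphi(a)$ iff $N\models\varphi(h(a))$. $\mathbb{T}_{ec}$ is the set of all coherent sequents over $\Sigma$ that hold in every existentially closed model of $\mathbb{T}$. * The models of $\mathbb{T}$ have *amalgamation* if for all homomorphisms $h_1:M\to M_1$, $h_2:M\to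 M_2$ of models of $\mathbb{T}$ there are a model $N$ of $\mathbb{T}$ and homomorphisms $k_i:M_i\to N$ with $k_1h_1=k_2h_2$. Theorem. 1. $\mathbb{T}$ satisfies De Morgan's law for coherent formulas if and only if $\mathbb{T}$ has a model completion. 2. $\mathbb{T}$ satisfies De Morgan's law for coherent formulas if and only if $\mathbb{T}$ has a model companion and the models of $\mathbb{T}$ have amalgamation. 3. For every coherent formula $\varphi$ in a finite context $x$: $\varphi^*$ and $\varphi^{**}$ exist and $\mathbb{T}$ proves $\top\vdash_x\varphi^*\vee\varphi^{**}$ if and only if $\varphi$ is strongly invariant in $(\mathbb{T}_{ec}\text{-Mod},\mathbb{T}\text{-Mod})$. -/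

import Mathlib

universe u

namespace CoherentLogic

/-- A (small, many-sorted, finitary) first-order signature: sorts, function symbols
`A₁, …, Aₙ → B` and relation symbols on `A₁, …, Aₙ`. The case `n = 0` is allowed. -/
structure Signature : Type (u + 1) where
  Srt : Type u
  Fn : List Srt → Srt → Type u
  Rl : List Srt → Type u

/-- `Var Γ A` is the set of variables (positions) of sort `A` in the finite context `Γ`. -/
inductive Var {S : Type u} : List S → S → Type u
  | here {Γ : List S} {A : S} : Var (A :: Γ) A
  | there {Γ : List S} {A B : S} : Var Γ B → Var (A :: Γ) B

/-- Terms of a given sort in context `Γ`. A symbol with arity list `As` is applied to a family of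
terms indexed by the positions of `As`. -/
inductive Term (S : Signature.{u}) (Γ : List S.Srt) : S.Srt → Type u
  | var {A : S.Srt} : Var Γ A → Term S Γ A
  | app {As : List S.Srt} {A : S.Srt} (f : S.Fn As A)
      (ts : ∀ B : S.Srt, Var As B → Term S Γ B) : Term S Γ A

/-- Coherent formulas in context `Γ`: built from atomic formulas (including equalities) by finite
conjunctions, finite disjunctions and existential quantification. -/
inductive Formula (S : Signature.{u}) : List S.Srt → Type u
  | rel {Γ As : List S.Srt} (R : S.Rl As) (ts : ∀ B : S.Srt, Var As B → Term S Γ B) : Formula S Γ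
  | eq {Γ : List S.Srt} {A : S.Srt} (s t : Term S Γ A) : Formula S Γ
  | top {Γ : List S.Srt} : Formula S Γ
  | bot {Γ : List S.Srt} : Formula S Γ
  | and {Γ : List S.Srt} (φ ψ : Formula S Γ) : Formula S Γ
  | or {Γ : List S.Srt} (φ ψ : Formula S Γ) : Formula S Γ
  | ex {Γ : List S.Srt} (A : S.Srt) (φ : Formula S (A :: Γ)) : Formula S Γ

/-- A substitution of terms in context `Δ` for the variables of `Γ`. -/
abbrev Subst (S : Signature.{u}) (Γ Δ : List S.Srt) : Type u :=
  ∀ A : S.Srt, Var Γ A → Term S Δ A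

def Term.subst {S : Signature.{u}} {Γ Δ : List S.Srt} (σ : Subst S Γ Δ) :
    ∀ {A : S.Srt}, Term S Γ A → Term S Δ A
  | _, .var v => σ _ v
  | _, .app f ts => .app f (fun B v => (ts B v).subst σ)

/-- The substitution regarding the variables of `Γ` as variables of `A :: Γ`. -/
def Subst.weaken (S : Signature.{u}) (Γ : List S.Srt) (A : S.Srt) : Subst S Γ (A :: Γ) :=
  fun _ v => .var (.there v)

/-- Extend a substitution by a term for the new variable. -/
def Subst.cons {S : Signature.{u}} {Γ Δ : List S.Srt} {A : S.Srt} (t : Term S Δ A)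
    (σ : Subst S Γ Δ) : Subst S (A :: Γ) Δ
  | _, .here => t
  | _, .there v => σ _ v

/-- The substitution `Γ, A → Δ, A` that is `σ` on `Γ` and fixes the last variable. -/
def Subst.lift {S : Signature.{u}} {Γ Δ : List S.Srt} (σ : Subst S Γ Δ) (A : S.Srt) :
    Subst S (A :: Γ) (A :: Δ) :=
  Subst.cons (.var .here) (fun B v => (σ B v).subst (Subst.weaken S Δ A))

/-- Substitution of the single term `t` for the last variable. -/
def Subst.single {S : Signature.{u}} {Γ : List S.Srt} {A : S.Srt} (t : Term S Γ A) :
    Subst S (A :: Γ) Γ :=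
  Subst.cons t (fun _ v => .var v)

/-- Capture-avoiding simultaneous substitution in formulas. -/
def Formula.subst {S : Signature.{u}} :
    ∀ {Γ Δ : List S.Srt}, Formula S Γ → Subst S Γ Δ → Formula S Δ
  | _, _, .rel R ts, σ => .rel R (fun B v => (ts B v).subst σ)
  | _, _, .eq s t, σ => .eq (s.subst σ) (t.subst σ)
  | _, _, .top, _ => .top
  | _, _, .bot, _ => .bot
  | _, _, .and φ ψ, σ => .and (φ.subst σ) (ψ.subst σ)
  | _, _, .or φ ψ, σ => .or (φ.subst σ) (ψ.subst σ)
  | _, _, .ex A φ, σ => .ex A (φ.subst (σ.lift A))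

/-- A coherent sequent `φ ⊢_Γ ψ`. -/
structure Sequent (S : Signature.{u}) : Type u where
  ctx : List S.Srt
  lhs : Formula S ctx
  rhs : Formula S ctx

/-- A coherent theory, given by a set of axioms which are coherent sequents. -/
abbrev Theory (S : Signature.{u}) : Type u := Set (Sequent S)

/-- `Provable T φ ψ`: the sequent `φ ⊢_Γ ψ` is derivable from `T` in (intuitionistic) coherent
logic. The rules are the usual ones of the sequent calculus of coherent logic. -/
inductive Provable {S : Signature.{u}} (T : Theory S) :
    ∀ {Γ : List S.Srt}, Formula S Γ → Formula S Γ → Prop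
  | axm (s : Sequent S) : s ∈ T → Provable T s.lhs s.rhs
  | refl {Γ : List S.Srt} (φ : Formula S Γ) : Provable T φ φ
  | cut {Γ : List S.Srt} {φ ψ χ : Formula S Γ} :
      Provable T φ ψ → Provable T ψ χ → Provable T φ χ
  | subst {Γ Δ : List S.Srt} {φ ψ : Formula S Γ} (σ : Subst S Γ Δ) :
      Provable T φ ψ → Provable T (φ.subst σ) (ψ.subst σ)
  | eqRefl {Γ : List S.Srt} {A : S.Srt} (t : Term S Γ A) : Provable T .top (.eq t t)
  | eqSubst {Γ : List S.Srt} {A : S.Srt} (s t : Term S Γ A) (φ : Formula S (A :: Γ)) :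
      Provable T (.and (.eq s t) (φ.subst (Subst.single s))) (φ.subst (Subst.single t))
  | topIntro {Γ : List S.Srt} (φ : Formula S Γ) : Provable T φ .top
  | andLeft {Γ : List S.Srt} (φ ψ : Formula S Γ) : Provable T (.and φ ψ) φ
  | andRight {Γ : List S.Srt} (φ ψ : Formula S Γ) : Provable T (.and φ ψ) ψ
  | andIntro {Γ : List S.Srt} {φ ψ χ : Formula S Γ} :
      Provable T φ ψ → Provable T φ χ → Provable T φ (.and ψ χ)
  | botElim {Γ : List S.Srt} (φ : Formula S Γ) : Provable T .bot φ
  | orLeft {Γ : List S.Srt} (φ ψ : Formula S Γ) : Provable T φ (.or φ ψ)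
  | orRight {Γ : List S.Srt} (φ ψ : Formula S Γ) : Provable T ψ (.or φ ψ)
  | orElim {Γ : List S.Srt} {φ ψ χ : Formula S Γ} :
      Provable T φ χ → Provable T ψ χ → Provable T (.or φ ψ) χ
  | exElim {Γ : List S.Srt} {A : S.Srt} {φ : Formula S (A :: Γ)} {ψ : Formula S Γ} :
      Provable T φ (ψ.subst (Subst.weaken S Γ A)) → Provable T (.ex A φ) ψ
  | exIntro {Γ : List S.Srt} {A : S.Srt} {φ : Formula S (A :: Γ)} {ψ : Formula S Γ} :
      Provable T (.ex A φ) ψ → Provable T φ (ψ.subst (Subst.weaken S Γ A))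
  | distrib {Γ : List S.Srt} (φ ψ χ : Formula S Γ) :
      Provable T (.and φ (.or ψ χ)) (.or (.and φ ψ) (.and φ χ))
  | frobenius {Γ : List S.Srt} {A : S.Srt} (φ : Formula S Γ) (ψ : Formula S (A :: Γ)) :
      Provable T (.and φ (.ex A ψ)) (.ex A (.and (φ.subst (Subst.weaken S Γ A)) ψ))

/-- The set of tuples of elements of a sorted family, of the sorts listed in `Γ`. -/
abbrev Env {S : Type u} (M : S → Type u) (Γ : List S) : Type u := ∀ A : S, Var Γ A → M A

/-- The tuple `a` with the element `m` for the new variable. -/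
def Env.cons {S : Type u} {M : S → Type u} {Γ : List S} {A : S} (m : M A) (a : Env M Γ) :
    Env M (A :: Γ)
  | _, .here => m
  | _, .there v => a _ v

/-- Set-based structures (carriers may be empty). -/
structure Str (S : Signature.{u}) : Type (u + 1) where
  carrier : S.Srt → Type u
  fn : ∀ {As : List S.Srt} {A : S.Srt}, S.Fn As A → Env carrier As → carrier A
  rl : ∀ {As : List S.Srt}, S.Rl As → Env carrier As → Prop

def Term.eval {S : Signature.{u}} (M : Str S) {Γ : List S.Srt} (a : Env M.carrier Γ) :
    ∀ {A : S.Srt}, Term S Γ A → M.carrier A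
  | _, .var v => a _ v
  | _, .app f ts => M.fn f (fun B v => (ts B v).eval M a)

/-- `φ.Holds M a`: the tuple `a` of `M` satisfies `φ`. -/
def Formula.Holds {S : Signature.{u}} (M : Str S) :
    ∀ {Γ : List S.Srt}, Formula S Γ → Env M.carrier Γ → Prop
  | _, .rel R ts, a => M.rl R (fun B v => (ts B v).eval M a)
  | _, .eq s t, a => s.eval M a = t.eval M a
  | _, .top, _ => True
  | _, .bot, _ => False
  | _, .and φ ψ, a => φ.Holds M a ∧ ψ.Holds M a
  | _, .or φ ψ, a => φ.Holds M a ∨ ψ.Holds M a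
  | _, .ex A φ, a => ∃ m : M.carrier A, φ.Holds M (Env.cons m a)

def Str.Sat {S : Signature.{u}} (M : Str S) (s : Sequent S) : Prop :=
  ∀ a : Env M.carrier s.ctx, s.lhs.Holds M a → s.rhs.Holds M a

/-- `M` is a model of `T`. -/
def Str.IsModel {S : Signature.{u}} (M : Str S) (T : Theory S) : Prop :=
  ∀ s ∈ T, M.Sat s

/-- Homomorphisms: they commute with the functions and preserve (not necessarily reflect) the
relations; they need not be injective. -/
structure Hom {S : Signature.{u}} (M N : Str S) : Type u where
  map : ∀ A : S.Srt, M.carrier A → N.carrier A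
  map_fn : ∀ {As : List S.Srt} {A : S.Srt} (f : S.Fn As A) (a : Env M.carrier As),
    map A (M.fn f a) = N.fn f (fun B v => map B (a B v))
  map_rl : ∀ {As : List S.Srt} (R : S.Rl As) (a : Env M.carrier As),
    M.rl R a → N.rl R (fun B v => map B (a B v))

/-- The image of a tuple under a homomorphism. -/
def Hom.onEnv {S : Signature.{u}} {M N : Str S} (h : Hom M N) {Γ : List S.Srt}
    (a : Env M.carrier Γ) : Env N.carrier Γ :=
  fun A v => h.map A (a A v)

/-- Every model of `T` maps homomorphically to a model of `T'`. -/
def ModelConsistent {S : Signature.{u}} (T' T : Theory S) : Prop :=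
  ∀ M : Str S, M.IsModel T → ∃ N : Str S, N.IsModel T' ∧ Nonempty (Hom M N)

/-- `φ` is strongly invariant in (models of `T'`, models of `T`). -/
def StronglyInvariant {S : Signature.{u}} (T' T : Theory S) {Γ : List S.Srt}
    (φ : Formula S Γ) : Prop :=
  ∀ M M₁ M₂ : Str S, M.IsModel T → M₁.IsModel T' → M₂.IsModel T' →
    ∀ (h₁ : Hom M M₁) (h₂ : Hom M M₂) (a : Env M.carrier Γ),
      φ.Holds M₁ (h₁.onEnv a) ↔ φ.Holds M₂ (h₂.onEnv a)

/-- `T'` is model complete relative to `T`. -/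
def ModelComplete {S : Signature.{u}} (T' T : Theory S) : Prop :=
  ∀ M M₁ M₂ : Str S, M.IsModel T → M₁.IsModel T' → M₂.IsModel T' →
    ∀ (h₁ : Hom M M₁) (h₂ : Hom M M₂) (Γ : List S.Srt) (φ : Formula S Γ) (a : Env M.carrier Γ),
      φ.Holds M₁ (h₁.onEnv a) ↔ φ.Holds M₂ (h₂.onEnv a)

/-- `T'` is a model companion of `T`. -/
def IsModelCompanion {S : Signature.{u}} (T' T : Theory S) : Prop :=
  ModelConsistent T' T ∧ ModelConsistent T T' ∧ ModelComplete T' T'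

/-- `T'` is a model completion of `T`. The inclusion of theories means that `T'` proves every
axiom of `T`. -/
def IsModelCompletion {S : Signature.{u}} (T' T : Theory S) : Prop :=
  (∀ s ∈ T, Provable T' s.lhs s.rhs) ∧ ModelConsistent T' T ∧ ModelComplete T' T

/-- The amalgamation property for the category of models of `T` and homomorphisms. -/
def Amalgamation {S : Signature.{u}} (T : Theory S) : Prop :=
  ∀ M M₁ M₂ : Str S, M.IsModel T → M₁.IsModel T → M₂.IsModel T →
    ∀ (h₁ : Hom M M₁) (h₂ : Hom M M₂),
      ∃ N : Str S, N.IsModel T ∧ ∃ (k₁ : Hom M₁ N) (k₂ : Hom M₂ N),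
        ∀ (A : S.Srt) (x : M.carrier A), k₁.map A (h₁.map A x) = k₂.map A (h₂.map A x)

/-- `M` is an existentially closed model of `T`. -/
def IsExistentiallyClosed {S : Signature.{u}} (T : Theory S) (M : Str S) : Prop :=
  M.IsModel T ∧ ∀ N : Str S, N.IsModel T → ∀ (h : Hom M N) (Γ : List S.Srt) (φ : Formula S Γ)
    (a : Env M.carrier Γ), φ.Holds M a ↔ φ.Holds N (h.onEnv a)

/-- The coherent theory of the existentially closed models of `T`. -/
def ecTheory {S : Signature.{u}} (T : Theory S) : Theory S :=
  {s | ∀ M : Str S, IsExistentiallyClosed T M → M.Sat s}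

/-- `ψ` is a coherent pseudo-complement of `φ` modulo `T`: among the coherent formulas in the
context `Γ`, ordered by `T`-provable entailment, it is the largest one whose meet with `φ` is the
least element. -/
def IsPseudoComplement {S : Signature.{u}} (T : Theory S) {Γ : List S.Srt}
    (φ ψ : Formula S Γ) : Prop :=
  ∀ χ : Formula S Γ, Provable T χ ψ ↔ Provable T (.and φ χ) .bot

/-- `φ*` and `φ**` exist, and `T` proves `φ* ∨ φ**`. -/
def DeMorganAt {S : Signature.{u}} (T : Theory S) {Γ : List S.Srt} (φ : Formula S Γ) : Prop :=
  ∃ ψ θ : Formula S Γ, IsPseudoComplement T φ ψ ∧ IsPseudoComplement T ψ θ ∧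
    Provable T .top (.or ψ θ)

/-- `T` satisfies De Morgan's law for coherent formulas (in every finite context). -/
def DeMorganCoherent {S : Signature.{u}} (T : Theory S) : Prop :=
  ∀ (Γ : List S.Srt) (φ : Formula S Γ), DeMorganAt T φ

end CoherentLogic

/-!
All three equivalences rest on the completeness theorem for coherent logic (`provable_iff`) and on
the method of diagrams.

The source of models is `exists_model`. Since carriers may be empty, the Henkin construction
cannot assume that the formal witnesses of existential formulas exist: Zorn's lemma is applied to
pairs `(D, G)`, where `D` is the set of witnesses that have been admitted so far and `G` a set of
formulas with parameters from `D`. Consistency of such a pair is tested in each finite context of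
elements of `D` separately, so infinite sets of parameters cause no trouble and the signature is
never extended. A maximal pair determines a canonical model (`IsComplete.holds_model`), and
maximality says that every formula false in it is refuted by a true one. If the construction
starts from the diagram of a model, the result is therefore existentially closed
(`exists_existentiallyClosed`), which gives the model consistency of `ecTheory T` relative to `T`.

If `φ*` and `φ**` exist and `φ* ∨ φ**` is provable, then a tuple of a model `M` of `T` satisfies
one of them, and homomorphisms preserve it. In models of `ecTheory T` the formula `φ*` excludes
`φ`, and `φ**` implies `φ`, as an existentially closed model refutes a false `φ` by a formula
which implies `φ*`. So `φ` is strongly invariant (`DeMorganAt.stronglyInvariant`). Conversely, let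
`T'` contain `T` and be model consistent relative to `T`, and let `φ` be strongly invariant. Each
tuple of a model of `T` then satisfies a formula from which `T'` either proves or refutes `φ`
(`exists_hom_or_provable`); by compactness a finite number of such formulas suffices, and their
disjunctions are `φ**` and `φ*` (`StronglyInvariant.deMorganAt`). This proves the local statement,
and the statement on model completions follows with `ecTheory T` as the model completion.

A model companion `T'` has only models of `T` as models, and is a model completion if the models
of `T` can be amalgamated, since homomorphisms into models of `T'` may then be compared in a
common extension (`IsModelCompanion.isModelCompletion`). Amalgamation in turn follows from De
Morgan's law: by strong invariance, a formula true in `M₁` of a tuple from `M` holds in any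
existentially closed extension `E` of `M₂`, and this suffices for `M₁` and `E` to have a common
extension over `M` (`exists_amalgam`).
-/

namespace CoherentLogic

variable {S : Signature.{u}}

/-! ### Substitution and renaming -/

theorem Term.subst_subst {Γ Δ Θ : List S.Srt} (σ : Subst S Γ Δ) (τ : Subst S Δ Θ) {A : S.Srt}
    (t : Term S Γ A) : (t.subst σ).subst τ = t.subst (fun B v => (σ B v).subst τ) := by
  induction t with
  | var v => rfl
  | app f ts ih =>
    simp only [Term.subst]
    congr 1
    funext B v
    exact ih B v

theorem Term.subst_var {Γ : List S.Srt} {A : S.Srt} (t : Term S Γ A) :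
    t.subst (fun _ v => .var v) = t := by
  induction t with
  | var v => rfl
  | app f ts ih =>
    simp only [Term.subst]
    congr 1
    funext B v
    exact ih B v

theorem Subst.lift_comp {Γ Δ Θ : List S.Srt} (σ : Subst S Γ Δ) (τ : Subst S Δ Θ) (A : S.Srt) :
    (fun B v => ((σ.lift A) B v).subst (τ.lift A)) =
      Subst.lift (fun B v => (σ B v).subst τ) A := by
  funext B v
  cases v with
  | here => rfl
  | there w =>
    change ((σ _ w).subst (Subst.weaken S Δ A)).subst (τ.lift A) =
      ((σ _ w).subst τ).subst (Subst.weaken S Θ A)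
    rw [Term.subst_subst, Term.subst_subst]
    rfl

theorem Subst.lift_var (Γ : List S.Srt) (A : S.Srt) :
    Subst.lift (fun _ v => .var v : Subst S Γ Γ) A = fun _ v => .var v := by
  funext B v
  cases v <;> rfl

theorem Formula.subst_subst {Γ Δ Θ : List S.Srt} (φ : Formula S Γ) (σ : Subst S Γ Δ)
    (τ : Subst S Δ Θ) : (φ.subst σ).subst τ = φ.subst (fun B v => (σ B v).subst τ) := by
  induction φ generalizing Δ Θ with
  | rel R ts => simp only [Formula.subst, Term.subst_subst]
  | eq s t => simp only [Formula.subst, Term.subst_subst]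
  | top => rfl
  | bot => rfl
  | and φ ψ ih₁ ih₂ => simp only [Formula.subst, ih₁, ih₂]
  | or φ ψ ih₁ ih₂ => simp only [Formula.subst, ih₁, ih₂]
  | ex A φ ih => simp only [Formula.subst, ih, Subst.lift_comp]

theorem Formula.subst_var {Γ : List S.Srt} (φ : Formula S Γ) :
    φ.subst (fun _ v => .var v) = φ := by
  induction φ with
  | rel R ts => simp only [Formula.subst, Term.subst_var]
  | eq s t => simp only [Formula.subst, Term.subst_var]
  | top => rfl
  | bot => rfl
  | and φ ψ ih₁ ih₂ => simp only [Formula.subst, ih₁, ih₂]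
  | or φ ψ ih₁ ih₂ => simp only [Formula.subst, ih₁, ih₂]
  | ex A φ ih => simp only [Formula.subst, Subst.lift_var, ih]

/-- A renaming of the variables of `Γ` by variables of `Δ`, of the same sorts. -/
abbrev Ren {C : Type u} (Γ Δ : List C) : Type u := ∀ A : C, Var Γ A → Var Δ A

/-- Renaming of variables in a formula, as the substitution by variables. -/
def Formula.ren {Γ Δ : List S.Srt} (φ : Formula S Γ) (ρ : Ren Γ Δ) : Formula S Δ :=
  φ.subst (fun A v => .var (ρ A v))

/-- The renaming `Γ, A → Δ, A` that is `ρ` on `Γ` and fixes the last variable. -/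
def Ren.lift {C : Type u} {Γ Δ : List C} (ρ : Ren Γ Δ) (A : C) : Ren (A :: Γ) (A :: Δ)
  | _, .here => .here
  | _, .there v => .there (ρ _ v)

/-- The renaming `Γ, A → Δ` that is `ρ` on `Γ` and sends the last variable to `w`. -/
def Ren.cons {C : Type u} {Γ Δ : List C} {A : C} (w : Var Δ A) (ρ : Ren Γ Δ) : Ren (A :: Γ) Δ
  | _, .here => w
  | _, .there v => ρ _ v

theorem Ren.lift_toSubst {Γ Δ : List S.Srt} (ρ : Ren Γ Δ) (A : S.Srt) :
    Subst.lift (fun B v => .var (ρ B v) : Subst S Γ Δ) A = fun B v => .var (ρ.lift A B v) := by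
  funext B v
  cases v <;> rfl

theorem Formula.ren_ren {Γ Δ Θ : List S.Srt} (φ : Formula S Γ) (ρ : Ren Γ Δ) (τ : Ren Δ Θ) :
    (φ.ren ρ).ren τ = φ.ren (fun A v => τ A (ρ A v)) :=
  Formula.subst_subst _ _ _

theorem Formula.ren_id {Γ : List S.Srt} (φ : Formula S Γ) : φ.ren (fun _ v => v) = φ :=
  Formula.subst_var φ

theorem Formula.ren_ex {Γ Δ : List S.Srt} {A : S.Srt} (φ : Formula S (A :: Γ)) (ρ : Ren Γ Δ) :
    (Formula.ex A φ).ren ρ = Formula.ex A (φ.ren (ρ.lift A)) := by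
  simp only [Formula.ren, Formula.subst, Ren.lift_toSubst]

theorem Provable.ren {T : Theory S} {Γ Δ : List S.Srt} {φ ψ : Formula S Γ}
    (h : Provable T φ ψ) (ρ : Ren Γ Δ) : Provable T (φ.ren ρ) (ψ.ren ρ) :=
  h.subst _

theorem Provable.andMono {T : Theory S} {Γ : List S.Srt} {φ φ' ψ ψ' : Formula S Γ}
    (h : Provable T φ φ') (h' : Provable T ψ ψ') : Provable T (.and φ ψ) (.and φ' ψ') :=
  .andIntro (.cut (.andLeft _ _) h) (.cut (.andRight _ _) h')

/-! ### Satisfaction and homomorphisms -/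

theorem Term.eval_subst (M : Str S) {Γ Δ : List S.Srt} (σ : Subst S Γ Δ) (a : Env M.carrier Δ)
    {A : S.Srt} (t : Term S Γ A) :
    (t.subst σ).eval M a = t.eval M (fun B v => (σ B v).eval M a) := by
  induction t with
  | var v => rfl
  | app f ts ih =>
    simp only [Term.subst, Term.eval]
    congr 1
    funext B v
    exact ih B v

theorem Subst.eval_lift (M : Str S) {Γ Δ : List S.Srt} (σ : Subst S Γ Δ) (a : Env M.carrier Δ)
    {A : S.Srt} (m : M.carrier A) :
    (fun B v => (σ.lift A B v).eval M (Env.cons m a)) =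
      Env.cons m (fun B v => (σ B v).eval M a) := by
  funext B v
  cases v with
  | here => rfl
  | there w =>
    change ((σ _ w).subst (Subst.weaken S Δ A)).eval M (Env.cons m a) = (σ _ w).eval M a
    rw [Term.eval_subst]
    rfl

theorem Formula.holds_subst (M : Str S) {Γ Δ : List S.Srt} (φ : Formula S Γ) (σ : Subst S Γ Δ)
    (a : Env M.carrier Δ) :
    (φ.subst σ).Holds M a ↔ φ.Holds M (fun B v => (σ B v).eval M a) := by
  induction φ generalizing Δ with
  | rel R ts => simp only [Formula.subst, Formula.Holds, Term.eval_subst]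
  | eq s t => simp only [Formula.subst, Formula.Holds, Term.eval_subst]
  | top => rfl
  | bot => rfl
  | and φ ψ ih₁ ih₂ => simp only [Formula.subst, Formula.Holds, ih₁, ih₂]
  | or φ ψ ih₁ ih₂ => simp only [Formula.subst, Formula.Holds, ih₁, ih₂]
  | ex A φ ih => simp only [Formula.subst, Formula.Holds, ih, Subst.eval_lift]

theorem Formula.holds_ren (M : Str S) {Γ Δ : List S.Srt} (φ : Formula S Γ) (ρ : Ren Γ Δ)
    (a : Env M.carrier Δ) : (φ.ren ρ).Holds M a ↔ φ.Holds M (fun B v => a B (ρ B v)) :=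
  Formula.holds_subst M φ _ a

theorem Provable.sound {T : Theory S} {M : Str S} (hM : M.IsModel T) {Γ : List S.Srt}
    {φ ψ : Formula S Γ} (h : Provable T φ ψ) (a : Env M.carrier Γ) :
    φ.Holds M a → ψ.Holds M a := by
  induction h with
  | axm s hs => exact hM s hs a
  | refl φ => exact id
  | cut _ _ ih₁ ih₂ => exact fun h => ih₂ a (ih₁ a h)
  | subst σ _ ih =>
    rw [Formula.holds_subst, Formula.holds_subst]
    exact ih _
  | eqRefl t => exact fun _ => rfl
  | @eqSubst Γ A s t φ =>
    rintro ⟨hst, h⟩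
    have hst : s.eval M a = t.eval M a := hst
    rw [Formula.holds_subst] at h ⊢
    convert h using 1
    funext B v
    cases v with
    | here => exact hst.symm
    | there w => rfl
  | topIntro φ => exact fun _ => trivial
  | andLeft φ ψ => exact fun h => h.1
  | andRight φ ψ => exact fun h => h.2
  | andIntro _ _ ih₁ ih₂ => exact fun h => ⟨ih₁ a h, ih₂ a h⟩
  | botElim φ => exact fun h => h.elim
  | orLeft φ ψ => exact Or.inl
  | orRight φ ψ => exact Or.inr
  | orElim _ _ ih₁ ih₂ => exact fun h => h.elim (ih₁ a) (ih₂ a)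
  | exElim _ ih =>
    rintro ⟨m, h⟩
    exact (Formula.holds_subst _ _ _ _).1 (ih (Env.cons m a) h)
  | exIntro _ ih =>
    intro h
    rw [Formula.holds_subst]
    refine ih _ ⟨a _ .here, ?_⟩
    convert h using 1
    funext B v
    cases v <;> rfl
  | distrib φ ψ χ =>
    rintro ⟨h, h' | h'⟩
    · exact Or.inl ⟨h, h'⟩
    · exact Or.inr ⟨h, h'⟩
  | frobenius φ ψ =>
    rintro ⟨h, m, h'⟩
    exact ⟨m, (Formula.holds_subst _ _ _ _).2 h, h'⟩

/-- The identity homomorphism. -/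
def Hom.id (M : Str S) : Hom M M := ⟨fun _ x => x, fun _ _ => rfl, fun _ _ h => h⟩

/-- Composition of homomorphisms, in the order of application. -/
def Hom.comp {M N K : Str S} (h : Hom M N) (k : Hom N K) : Hom M K where
  map A x := k.map A (h.map A x)
  map_fn f a := by rw [h.map_fn, k.map_fn]
  map_rl R a hR := k.map_rl R _ (h.map_rl R a hR)

theorem Hom.map_eval {M N : Str S} (h : Hom M N) {Γ : List S.Srt} (a : Env M.carrier Γ)
    {A : S.Srt} (t : Term S Γ A) : h.map A (t.eval M a) = t.eval N (h.onEnv a) := by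
  induction t with
  | var v => rfl
  | app f ts ih =>
    simp only [Term.eval, h.map_fn]
    congr 1
    funext B v
    exact ih B v

theorem Hom.onEnv_cons {M N : Str S} (h : Hom M N) {Γ : List S.Srt} (a : Env M.carrier Γ)
    {A : S.Srt} (m : M.carrier A) :
    h.onEnv (Env.cons m a) = Env.cons (h.map A m) (h.onEnv a) := by
  funext B v
  cases v <;> rfl

theorem Hom.holds {M N : Str S} (h : Hom M N) {Γ : List S.Srt} (φ : Formula S Γ)
    (a : Env M.carrier Γ) : φ.Holds M a → φ.Holds N (h.onEnv a) := by
  induction φ with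
  | rel R ts =>
    intro hR
    have := h.map_rl R _ hR
    simp only [h.map_eval] at this
    exact this
  | eq s t =>
    intro hst
    have hst : s.eval M a = t.eval M a := hst
    change s.eval N _ = t.eval N _
    rw [← h.map_eval, ← h.map_eval, hst]
  | top => exact fun _ => trivial
  | bot => exact fun h => h
  | and φ ψ ih₁ ih₂ => exact fun h => ⟨ih₁ a h.1, ih₂ a h.2⟩
  | or φ ψ ih₁ ih₂ => exact fun h => h.imp (ih₁ a) (ih₂ a)
  | ex A φ ih =>
    rintro ⟨m, hm⟩
    refine ⟨h.map A m, ?_⟩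
    rw [← h.onEnv_cons]
    exact ih _ hm

/-- A map between structures that preserves all coherent formulas is a homomorphism; it is enough
to know this for the formulas `f(x) = y` and `R(x)`. -/
def Hom.ofHolds {M N : Str S} (f : ∀ A, M.carrier A → N.carrier A)
    (hf : ∀ (Γ : List S.Srt) (φ : Formula S Γ) (a : Env M.carrier Γ), φ.Holds M a →
      φ.Holds N (fun A v => f A (a A v))) : Hom M N where
  map := f
  map_fn {As A} g a :=
    hf (A :: As) (.eq (.var .here) (.app g fun _ v => .var (.there v))) (Env.cons (M.fn g a) a) rfl
  map_rl R a h := hf _ (.rel R fun _ v => .var v) a h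

/-! ### Images of formulas along renamings -/

/-- The injection of the first context into the concatenation. -/
def Var.inl {C : Type u} {Γ : List C} : ∀ {Δ : List C} {A : C}, Var Δ A → Var (Δ ++ Γ) A
  | _, _, .here => .here
  | _, _, .there v => .there v.inl

/-- The injection of the second context into the concatenation. -/
def Var.inr {C : Type u} {Γ : List C} : ∀ {Δ : List C} {A : C}, Var Γ A → Var (Δ ++ Γ) A
  | [], _, v => v
  | _ :: Δ, _, v => .there (Var.inr (Δ := Δ) v)

/-- Concatenation of tuples. -/
def Env.append {C : Type u} {M : C → Type u} {Γ : List C} (a : Env M Γ) :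
    ∀ {Δ : List C}, Env M Δ → Env M (Δ ++ Γ)
  | [], _ => a
  | _ :: _, d => Env.cons (d _ .here) (Env.append a fun _ v => d _ (.there v))

theorem Env.append_inl {C : Type u} {M : C → Type u} {Γ : List C} (a : Env M Γ) {Δ : List C}
    (d : Env M Δ) {A : C} (v : Var Δ A) : Env.append a d A v.inl = d A v := by
  induction v with
  | here => rfl
  | there v ih => exact ih (fun _ v => d _ (.there v))

theorem Env.append_inr {C : Type u} {M : C → Type u} {Γ : List C} (a : Env M Γ) {Δ : List C}
    (d : Env M Δ) {A : C} (v : Var Γ A) : Env.append a d A v.inr = a A v := by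
  induction Δ with
  | nil => rfl
  | cons B Δ ih => exact ih (fun _ v => d _ (.there v))

/-- Existential quantification over all variables of `Δ`. -/
def Formula.exAll {Γ : List S.Srt} : ∀ {Δ : List S.Srt}, Formula S (Δ ++ Γ) → Formula S Γ
  | [], φ => φ
  | A :: Δ, φ => Formula.exAll (Δ := Δ) (.ex A φ)

theorem Formula.holds_exAll (M : Str S) {Γ Δ : List S.Srt} (φ : Formula S (Δ ++ Γ))
    (a : Env M.carrier Γ) :
    (Formula.exAll φ).Holds M a ↔ ∃ d : Env M.carrier Δ, φ.Holds M (Env.append a d) := by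
  induction Δ with
  | nil => exact ⟨fun h => ⟨(fun _ v => nomatch v), h⟩, fun ⟨_, h⟩ => h⟩
  | cons A Δ ih =>
    refine (ih (.ex A φ)).trans ⟨?_, ?_⟩
    · rintro ⟨d, m, h⟩
      exact ⟨Env.cons m d, h⟩
    · rintro ⟨d, h⟩
      exact ⟨fun _ v => d _ (.there v), d _ .here, h⟩

/-- The conjunction of the equations `σ v = τ v`, for all variables `v` of `Γ`. -/
def Formula.eqs {Δ : List S.Srt} : ∀ {Γ : List S.Srt}, Subst S Γ Δ → Subst S Γ Δ → Formula S Δ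
  | [], _, _ => .top
  | _ :: _, σ, τ => .and (.eq (σ _ .here) (τ _ .here))
      (Formula.eqs (fun _ v => σ _ (.there v)) (fun _ v => τ _ (.there v)))

theorem Formula.holds_eqs (M : Str S) {Γ Δ : List S.Srt} (σ τ : Subst S Γ Δ)
    (a : Env M.carrier Δ) :
    (Formula.eqs σ τ).Holds M a ↔ ∀ A v, (σ A v).eval M a = (τ A v).eval M a := by
  induction Γ with
  | nil => exact ⟨(fun _ _ v => nomatch v), fun _ => trivial⟩
  | cons A Γ ih =>
    refine (and_congr Iff.rfl (ih _ _)).trans ⟨?_, fun h => ⟨h _ _, fun _ _ => h _ _⟩⟩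
    rintro ⟨h, h'⟩ B v
    cases v with
    | here => exact h
    | there v => exact h' _ v

/-- The image of `χ` along the renaming `σ : Γ → Θ`: the formula in context `Γ` which says that
the tuple extends along `σ` to a tuple satisfying `χ`. -/
def Formula.image {Γ Θ : List S.Srt} (σ : Ren Γ Θ) (χ : Formula S Θ) : Formula S Γ :=
  Formula.exAll (Δ := Θ) (.and (χ.ren fun _ v => v.inl)
    (Formula.eqs (fun A v => .var (Var.inl (σ A v))) (fun _ v => .var v.inr)))

theorem Formula.holds_image (M : Str S) {Γ Θ : List S.Srt} (σ : Ren Γ Θ) (χ : Formula S Θ)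
    (a : Env M.carrier Γ) :
    (χ.image σ).Holds M a ↔ ∃ u : Env M.carrier Θ, χ.Holds M u ∧ (fun A v => u A (σ A v)) = a := by
  rw [Formula.image, Formula.holds_exAll]
  refine exists_congr fun u => and_congr ?_ ?_
  · rw [Formula.holds_ren]
    simp only [Env.append_inl]
  · rw [Formula.holds_eqs]
    simp only [Term.eval, Env.append_inl, Env.append_inr]
    exact ⟨fun h => funext fun A => funext fun v => h A v, fun h A v => congrFun (congrFun h A) v⟩

/-! ### Tuples and contexts -/

/-- Restriction of a tuple along a renaming of its positions. -/
abbrev Env.pull {C : Type u} {X : C → Type u} {Γ Δ : List C} (e : Env X Δ) (ρ : Ren Γ Δ) :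
    Env X Γ :=
  fun A v => e A (ρ A v)

theorem Var.nil_elim {C : Type u} {A : C} {p : Prop} (v : Var ([] : List C) A) : p :=
  nomatch v

/-- The renaming of no variables. -/
def Ren.nil {C : Type u} {Γ : List C} : Ren [] Γ := fun _ v => nomatch v

/-- The empty tuple. -/
def Env.nil {C : Type u} {X : C → Type u} : Env X ([] : List C) := fun _ v => nomatch v

theorem Env.nil_ext {C : Type u} {X : C → Type u} (e d : Env X ([] : List C)) : e = d :=
  funext fun _ => funext fun v => v.nil_elim

/-- A tuple without repetitions. -/
def Env.Inj {C : Type u} {X : C → Type u} {Γ : List C} (e : Env X Γ) : Prop :=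
  ∀ (A : C) (v w : Var Γ A), e A v = e A w → v = w

/-- All entries of the tuple belong to `D`. -/
def Env.In {C : Type u} {X : C → Type u} (D : Set (Σ A, X A)) {Γ : List C} (e : Env X Γ) : Prop :=
  ∀ (A : C) (v : Var Γ A), (⟨A, e A v⟩ : Σ A, X A) ∈ D

theorem Env.In.mono {C : Type u} {X : C → Type u} {D D' : Set (Σ A, X A)} (h : D ⊆ D')
    {Γ : List C} {e : Env X Γ} (he : e.In D) : e.In D' :=
  fun A v => h (he A v)

theorem Env.In.cons {C : Type u} {X : C → Type u} {D : Set (Σ A, X A)} {Γ : List C} {A : C}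
    {c : X A} {e : Env X Γ} (hc : (⟨A, c⟩ : Σ A, X A) ∈ D) (he : e.In D) :
    (Env.cons c e).In D := by
  intro B v
  cases v with
  | here => exact hc
  | there v => exact he _ v

theorem Env.cons_pull {C : Type u} {X : C → Type u} {Γ Δ : List C} {A : C} (c : X A)
    (e : Env X Δ) (ρ : Ren Γ Δ) : (Env.cons c e).pull (ρ.lift A) = Env.cons c (e.pull ρ) := by
  funext B v
  cases v <;> rfl

theorem Env.pull_cons {C : Type u} {X : C → Type u} {Γ Δ : List C} {A : C} (w : Var Δ A)
    (e : Env X Δ) (ρ : Ren Γ Δ) : e.pull (Ren.cons w ρ) = Env.cons (e A w) (e.pull ρ) := by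
  funext B v
  cases v <;> rfl

theorem Env.Inj.ren_eq {C : Type u} {X : C → Type u} {Γ Δ : List C} {e : Env X Δ} (he : e.Inj)
    {ρ τ : Ren Γ Δ} (h : e.pull ρ = e.pull τ) : ρ = τ :=
  funext fun A => funext fun v => he A _ _ (congrFun (congrFun h A) v)

theorem Env.Inj.cons {C : Type u} {X : C → Type u} {Γ : List C} {A : C} {c : X A} {e : Env X Γ}
    (he : e.Inj) (hc : ∀ v : Var Γ A, e A v ≠ c) : (Env.cons c e).Inj := by
  intro B v w h
  cases v with
  | here =>
    cases w with
    | here => rfl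
    | there w => exact (hc w h.symm).elim
  | there v =>
    cases w with
    | here => exact (hc v h).elim
    | there w => exact congrArg _ (he _ v w h)

theorem Env.exists_merge_of_inj {C : Type u} {X : C → Type u} (D : Set (Σ A, X A)) {Γ : List C}
    (e : Env X Γ) (hi : e.Inj) (he : e.In D) {Δ : List C} (d : Env X Δ) (hd : d.In D) :
    ∃ (Θ : List C) (u : Env X Θ) (ρ : Ren Γ Θ) (τ : Ren Δ Θ),
      u.Inj ∧ u.In D ∧ u.pull ρ = e ∧ u.pull τ = d := by
  induction Δ with
  | nil => exact ⟨Γ, e, fun _ v => v, Ren.nil, hi, he, rfl, Env.nil_ext _ _⟩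
  | cons A Δ ih =>
    obtain ⟨Θ, u, ρ, τ, hu, huD, rfl, h⟩ := ih (fun _ v => d _ (.there v)) (fun _ v => hd _ _)
    have hd' : d = Env.cons (d A .here) (u.pull τ) := by
      rw [h]
      funext B v
      cases v <;> rfl
    by_cases hx : ∃ w, u A w = d A .here
    · obtain ⟨w, hw⟩ := hx
      refine ⟨Θ, u, ρ, Ren.cons w τ, hu, huD, rfl, ?_⟩
      rw [Env.pull_cons, hw, ← hd']
    · push Not at hx
      refine ⟨A :: Θ, Env.cons (d A .here) u, fun _ v => .there (ρ _ v), τ.lift A,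
        hu.cons hx, huD.cons (hd _ _), rfl, ?_⟩
      rw [Env.cons_pull, ← hd']

/-- Any two tuples with entries in `D` are restrictions of a single tuple without repetitions. -/
theorem Env.exists_merge {C : Type u} {X : C → Type u} (D : Set (Σ A, X A)) {Γ Δ : List C}
    (e : Env X Γ) (he : e.In D) (d : Env X Δ) (hd : d.In D) :
    ∃ (Θ : List C) (u : Env X Θ) (ρ : Ren Γ Θ) (τ : Ren Δ Θ),
      u.Inj ∧ u.In D ∧ u.pull ρ = e ∧ u.pull τ = d := by
  obtain ⟨Θ, u, -, ρ, hu, huD, -, rfl⟩ := Env.exists_merge_of_inj (Γ := []) D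
    Env.nil (fun _ v => v.nil_elim) (fun _ v => v.nil_elim) e he
  obtain ⟨Θ', u', ρ', τ, hu', huD', rfl, h⟩ := Env.exists_merge_of_inj D u hu huD d hd
  exact ⟨Θ', u', fun _ v => ρ' _ (ρ _ v), τ, hu', huD', rfl, h⟩

/-- A tuple with entries in `D ∪ {c}` is a restriction of `c` followed by a tuple without
repetitions with entries in `D`. -/
theorem Env.exists_pull_cons {C : Type u} {X : C → Type u} (D : Set (Σ A, X A)) {A : C} (c : X A)
    {Γ Δ : List C} (e : Env X Γ) (he : e.In (insert ⟨A, c⟩ D)) (d : Env X Δ) (hd : d.In D) :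
    ∃ (Θ : List C) (u : Env X Θ) (κ : Ren Γ (A :: Θ)) (τ : Ren Δ Θ),
      u.Inj ∧ u.In D ∧ (Env.cons c u).pull κ = e ∧ u.pull τ = d := by
  induction Γ with
  | nil =>
    obtain ⟨Θ, u, -, τ, hu, huD, -, rfl⟩ := Env.exists_merge (Γ := []) D
      Env.nil (fun _ v => v.nil_elim) d hd
    exact ⟨Θ, u, Ren.nil, τ, hu, huD, Env.nil_ext _ _, rfl⟩
  | cons B Γ ih =>
    obtain ⟨Θ, u, κ, τ, hu, huD, h, rfl⟩ := ih (fun _ v => e _ (.there v)) (fun _ v => he _ _)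
    rcases he B .here with hB | hB
    · have hBA : B = A := congrArg Sigma.fst hB
      subst hBA
      have hc : e B .here = c := eq_of_heq (Sigma.mk.inj hB).2
      refine ⟨Θ, u, Ren.cons .here κ, τ, hu, huD, ?_, rfl⟩
      rw [Env.pull_cons, h]
      funext B v
      cases v with
      | here => exact hc.symm
      | there v => rfl
    · obtain ⟨Θ', u', ρ, α, hu', huD', rfl, hα⟩ := Env.exists_merge (Δ := [B]) D u huD
        (Env.cons (e B .here) Env.nil) (Env.In.cons hB fun _ v => v.nil_elim)
      refine ⟨Θ', u', Ren.cons (.there (α B .here)) (fun _ v => ρ.lift A _ (κ _ v)),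
        fun _ v => ρ _ (τ _ v), hu', huD', ?_, rfl⟩
      have hB' : u' B (α B .here) = e B .here := congrFun (congrFun hα B) .here
      rw [← Env.cons_pull] at h
      rw [Env.pull_cons]
      funext E v
      cases v with
      | here => exact hB'
      | there v => exact congrFun (congrFun h E) v

/-- The variables of `Θ` with a given property form a subcontext. -/
theorem Ren.exists_subcontext {C : Type u} {Θ : List C} (p : ∀ A : C, Var Θ A → Prop) :
    ∃ (Γ : List C) (σ : Ren Γ Θ), (∀ A v w, σ A v = σ A w → v = w) ∧ (∀ A v, p A (σ A v)) ∧
      ∀ A v, p A v → ∃ w, σ A w = v := by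
  induction Θ with
  | nil => exact ⟨[], Ren.nil, fun _ v => v.nil_elim, fun _ v => v.nil_elim,
      fun _ v => v.nil_elim⟩
  | cons B Θ ih =>
    obtain ⟨Γ, σ, hi, h₁, h₂⟩ := ih (fun A v => p A (.there v))
    by_cases hB : p B .here
    · refine ⟨B :: Γ, σ.lift B, ?_, ?_, ?_⟩
      · intro A v w h
        cases v with
        | here =>
          cases w with
          | here => rfl
          | there w => cases h
        | there v =>
          cases w with
          | here => cases h
          | there w => exact congrArg _ (hi _ _ _ (Var.there.inj h))
      · intro A v
        cases v with
        | here => exact hB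
        | there v => exact h₁ _ v
      · intro A v hv
        cases v with
        | here => exact ⟨.here, rfl⟩
        | there v =>
          obtain ⟨w, rfl⟩ := h₂ _ v hv
          exact ⟨.there w, rfl⟩
    · refine ⟨Γ, fun _ v => .there (σ _ v), fun A v w h => hi _ _ _ (Var.there.inj h),
        fun A v => h₁ A v, ?_⟩
      intro A v hv
      cases v with
      | here => exact (hB hv).elim
      | there v =>
        obtain ⟨w, rfl⟩ := h₂ _ v hv
        exact ⟨w, rfl⟩

/-! ### Deductive closure over an arbitrary set of parameters -/

/-- Coherent formulas with parameters in the sorted set `X`: a formula in a finite context together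
with a tuple of elements of `X` of the sorts of the context. -/
abbrev PFormula (S : Signature.{u}) (X : S.Srt → Type u) : Type u :=
  Σ Γ : List S.Srt, Env X Γ × Formula S Γ

/-- `Der T G u ξ`: the formula `ξ(u)` follows in `T` from finitely many members of `G` whose
parameters are all listed in `u`. -/
inductive Der (T : Theory S) {X : S.Srt → Type u} (G : Set (PFormula S X)) {Θ : List S.Srt}
    (u : Env X Θ) : Formula S Θ → Prop
  | base {Γ : List S.Srt} (φ : Formula S Γ) (σ : Ren Γ Θ) :
      (⟨Γ, u.pull σ, φ⟩ : PFormula S X) ∈ G → Der T G u (φ.ren σ)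
  | top : Der T G u .top
  | and {φ ψ : Formula S Θ} : Der T G u φ → Der T G u ψ → Der T G u (.and φ ψ)
  | mono {φ ψ : Formula S Θ} : Der T G u φ → Provable T φ ψ → Der T G u ψ

theorem Der.self {T : Theory S} {X : S.Srt → Type u} {G : Set (PFormula S X)} {Θ : List S.Srt}
    {u : Env X Θ} {φ : Formula S Θ} (h : (⟨Θ, u, φ⟩ : PFormula S X) ∈ G) : Der T G u φ := by
  have := Der.base (T := T) (u := u) φ (fun _ v => v) h
  rwa [Formula.ren_id] at this

theorem Der.weaken {T : Theory S} {X : S.Srt → Type u} {G G' : Set (PFormula S X)} (hG : G ⊆ G')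
    {Θ : List S.Srt} {u : Env X Θ} {φ : Formula S Θ} (h : Der T G u φ) : Der T G' u φ := by
  induction h with
  | base φ σ h => exact .base φ σ (hG h)
  | top => exact .top
  | and _ _ h₁ h₂ => exact .and h₁ h₂
  | mono _ h h₁ => exact .mono h₁ h

theorem Der.ren {T : Theory S} {X : S.Srt → Type u} {G : Set (PFormula S X)} {Γ Θ : List S.Srt}
    {u : Env X Θ} {τ : Ren Γ Θ} {φ : Formula S Γ} (h : Der T G (u.pull τ) φ) :
    Der T G u (φ.ren τ) := by
  induction h with
  | base φ σ h =>
    rw [Formula.ren_ren]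
    exact .base φ _ h
  | top => exact .top
  | and _ _ h₁ h₂ => exact .and h₁ h₂
  | mono _ h h₁ => exact .mono h₁ (h.ren τ)

theorem Der.of_insert {T : Theory S} {X : S.Srt → Type u} {G : Set (PFormula S X)}
    {Γ Θ : List S.Srt} {u : Env X Θ} (hu : u.Inj) {φ : Formula S Γ} (σ : Ren Γ Θ)
    {ξ : Formula S Θ} (h : Der T (insert ⟨Γ, u.pull σ, φ⟩ G) u ξ) :
    ∃ χ, Der T G u χ ∧ Provable T (.and χ (φ.ren σ)) ξ := by
  induction h with
  | @base Γ' φ' σ' h =>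
    rcases h with h | h
    · have hΓ : Γ' = Γ := congrArg Sigma.fst h
      subst hΓ
      have h' := Prod.mk.inj (eq_of_heq (Sigma.mk.inj h).2)
      obtain rfl := hu.ren_eq h'.1
      obtain rfl := h'.2
      exact ⟨.top, .top, .andRight _ _⟩
    · exact ⟨_, .base φ' σ' h, .andLeft _ _⟩
  | top => exact ⟨.top, .top, .topIntro _⟩
  | and _ _ h₁ h₂ =>
    obtain ⟨χ₁, d₁, p₁⟩ := h₁
    obtain ⟨χ₂, d₂, p₂⟩ := h₂
    exact ⟨.and χ₁ χ₂, .and d₁ d₂, .andIntro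
      (.cut (.andMono (.andLeft _ _) (.refl _)) p₁) (.cut (.andMono (.andRight _ _) (.refl _)) p₂)⟩
  | mono _ h h₁ =>
    obtain ⟨χ, d, p⟩ := h₁
    exact ⟨χ, d, .cut p h⟩

/-- The case of a new formula `φ(c, e)` with a parameter `c` that does not occur in `G`. -/
theorem Der.of_insert_fresh {T : Theory S} {X : S.Srt → Type u} {G : Set (PFormula S X)}
    {D : Set (Σ A, X A)} (hG : ∀ x ∈ G, x.2.1.In D) {A : S.Srt} {c : X A}
    (hc : (⟨A, c⟩ : Σ A, X A) ∉ D) {Γ Θ : List S.Srt} {u : Env X Θ} (hu : u.Inj) (huD : u.In D)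
    {φ : Formula S (A :: Γ)} (σ : Ren Γ Θ) {ξ : Formula S (A :: Θ)}
    (h : Der T (insert ⟨A :: Γ, Env.cons c (u.pull σ), φ⟩ G) (Env.cons c u) ξ) :
    ∃ χ, Der T G u χ ∧
      Provable T (.and (χ.subst (Subst.weaken S Θ A)) (φ.ren (σ.lift A))) ξ := by
  have hi : (Env.cons c u).Inj := hu.cons fun v hv => hc (hv ▸ huD A v)
  induction h with
  | @base Γ' φ' σ' h =>
    rcases h with h | h
    · have hΓ : Γ' = A :: Γ := congrArg Sigma.fst h
      subst hΓ
      have h' := Prod.mk.inj (eq_of_heq (Sigma.mk.inj h).2)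
      obtain rfl := hi.ren_eq (h'.1.trans (Env.cons_pull c u σ).symm)
      obtain rfl := h'.2
      exact ⟨.top, .top, .andRight _ _⟩
    · -- The parameters of a member of `G` differ from `c`, so its renaming avoids the variable `c`.
      have key : ∀ B (v : Var Γ' B), ∃ w, σ' B v = .there w := by
        intro B v
        have := hG _ h B v
        change (⟨B, Env.cons c u B (σ' B v)⟩ : Σ A, X A) ∈ D at this
        generalize σ' B v = x at this
        cases x with
        | here => exact (hc this).elim
        | there w => exact ⟨w, rfl⟩
      choose τ hτ using key
      obtain rfl : σ' = fun B v => .there (τ B v) := funext fun B => funext fun v => hτ B v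
      refine ⟨φ'.ren τ, .base φ' τ h, ?_⟩
      change Provable T (.and ((φ'.ren τ).ren fun _ v => .there v) _) _
      rw [Formula.ren_ren]
      exact .andLeft _ _
  | top => exact ⟨.top, .top, .topIntro _⟩
  | and _ _ h₁ h₂ =>
    obtain ⟨χ₁, d₁, p₁⟩ := h₁
    obtain ⟨χ₂, d₂, p₂⟩ := h₂
    exact ⟨.and χ₁ χ₂, .and d₁ d₂, .andIntro
      (.cut (.andMono (.andLeft _ _) (.refl _)) p₁) (.cut (.andMono (.andRight _ _) (.refl _)) p₂)⟩
  | mono _ h h₁ =>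
    obtain ⟨χ, d, p⟩ := h₁
    exact ⟨χ, d, .cut p h⟩

/-! ### Maximal consistent sets with witnesses -/

/-- `X` together with a formal witness for every existential formula with parameters. -/
inductive Witness (S : Signature.{u}) (X : S.Srt → Type u) : S.Srt → Type u
  | base {A : S.Srt} : X A → Witness S X A
  | wit {Γ : List S.Srt} {A : S.Srt} (φ : Formula S (A :: Γ))
      (e : ∀ B : S.Srt, Var Γ B → Witness S X B) : Witness S X A

/-- `G` does not entail any `q(e₀)`, `q ∈ Q`, where only parameters from `D` are used. The
restriction to `D` matters, as the existence of elements is not provable when carriers may be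
empty. -/
def Consistent (T : Theory S) {X : S.Srt → Type u} {Γ₀ : List S.Srt} (e₀ : Env X Γ₀)
    (Q : Set (Formula S Γ₀)) (D : Set (Σ A, X A)) (G : Set (PFormula S X)) : Prop :=
  ∀ (Θ : List S.Srt) (u : Env X Θ), u.Inj → u.In D → ∀ κ : Ren Γ₀ Θ, u.pull κ = e₀ →
    ∀ q ∈ Q, ¬ Der T G u (q.ren κ)

/-- A stage of the Henkin construction: a set `p.1` of elements that exist, and a set `p.2` of
formulas about them, which contains the defining formula of every formal witness in `p.1`. -/
structure Stage (T : Theory S) {X : S.Srt → Type u} {Γ₀ : List S.Srt}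
    (e₀ : Env (Witness S X) Γ₀) (Q : Set (Formula S Γ₀))
    (p : Set (Σ A, Witness S X A) × Set (PFormula S (Witness S X))) : Prop where
  supp : ∀ x ∈ p.2, x.2.1.In p.1
  henkin : ∀ {Γ : List S.Srt} {A : S.Srt} (φ : Formula S (A :: Γ)) (e : Env (Witness S X) Γ),
    (⟨A, .wit φ e⟩ : Σ A, Witness S X A) ∈ p.1 →
      (⟨A :: Γ, Env.cons (.wit φ e) e, φ⟩ : PFormula S (Witness S X)) ∈ p.2
  cons : Consistent T e₀ Q p.1 p.2

theorem Env.In.exists_of_chain {C : Type u} {X : C → Type u} {Y : Type u}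
    {c : Set (Set (Σ A, X A) × Y)} [Preorder Y] (hc : IsChain (· ≤ ·) c) (hne : c.Nonempty)
    {Γ : List C} {e : Env X Γ} (he : e.In (⋃ p ∈ c, p.1)) : ∃ p ∈ c, e.In p.1 := by
  induction Γ with
  | nil =>
    obtain ⟨p, hp⟩ := hne
    exact ⟨p, hp, fun _ v => v.nil_elim⟩
  | cons A Γ ih =>
    obtain ⟨p, hp, h⟩ := ih (e := fun _ v => e _ (.there v)) fun _ v => he _ _
    have h' := he A .here
    simp only [Set.mem_iUnion, exists_prop] at h'
    obtain ⟨p', hp', h'⟩ := h'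
    rcases hc.total hp hp' with hle | hle
    · refine ⟨p', hp', fun B v => ?_⟩
      cases v with
      | here => exact h'
      | there v => exact hle.1 (h _ v)
    · refine ⟨p, hp, fun B v => ?_⟩
      cases v with
      | here => exact hle.1 h'
      | there v => exact h _ v

theorem Der.exists_of_chain {T : Theory S} {X : S.Srt → Type u} {Y : Type u} [Preorder Y]
    {c : Set (Y × Set (PFormula S X))} (hc : IsChain (· ≤ ·) c) (hne : c.Nonempty)
    {Θ : List S.Srt} {u : Env X Θ} {ξ : Formula S Θ} (h : Der T (⋃ p ∈ c, p.2) u ξ) :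
    ∃ p ∈ c, Der T p.2 u ξ := by
  induction h with
  | base φ σ h =>
    simp only [Set.mem_iUnion, exists_prop] at h
    obtain ⟨p, hp, h⟩ := h
    exact ⟨p, hp, .base φ σ h⟩
  | top =>
    obtain ⟨p, hp⟩ := hne
    exact ⟨p, hp, .top⟩
  | and _ _ h₁ h₂ =>
    obtain ⟨p, hp, h⟩ := h₁
    obtain ⟨p', hp', h'⟩ := h₂
    rcases hc.total hp hp' with hle | hle
    · exact ⟨p', hp', .and (h.weaken hle.2) h'⟩
    · exact ⟨p, hp, .and h (h'.weaken hle.2)⟩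
  | mono _ h h₁ =>
    obtain ⟨p, hp, h'⟩ := h₁
    exact ⟨p, hp, .mono h' h⟩

theorem Stage.exists_maximal {T : Theory S} {X : S.Srt → Type u} {Γ₀ : List S.Srt}
    {e₀ : Env (Witness S X) Γ₀} {Q : Set (Formula S Γ₀)}
    {p : Set (Σ A, Witness S X A) × Set (PFormula S (Witness S X))} (hp : Stage T e₀ Q p) :
    ∃ m, p ≤ m ∧ Maximal (Stage T e₀ Q) m := by
  refine zorn_le_nonempty₀ {p | Stage T e₀ Q p} ?_ p hp
  intro c hcs hc y hy
  refine ⟨(⋃ p ∈ c, p.1, ⋃ p ∈ c, p.2), ⟨?_, ?_, ?_⟩, fun z hz =>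
    ⟨Set.subset_biUnion_of_mem hz, Set.subset_biUnion_of_mem (u := fun p => p.2) hz⟩⟩
  · intro x hx
    simp only [Set.mem_iUnion, exists_prop] at hx
    obtain ⟨p, hp, hx⟩ := hx
    exact ((hcs hp).supp x hx).mono (Set.subset_biUnion_of_mem (u := fun p => p.1) hp)
  · intro Γ A φ e h
    simp only [Set.mem_iUnion, exists_prop] at h ⊢
    obtain ⟨p, hp, h⟩ := h
    exact ⟨p, hp, (hcs hp).henkin φ e h⟩
  · intro Θ u hu huD κ hκ q hq h
    obtain ⟨p, hp, huD⟩ := huD.exists_of_chain hc ⟨y, hy⟩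
    obtain ⟨p', hp', h⟩ := h.exists_of_chain hc ⟨y, hy⟩
    rcases hc.total hp hp' with hle | hle
    · exact (hcs hp').cons Θ u hu (huD.mono hle.1) κ hκ q hq h
    · exact (hcs hp).cons Θ u hu huD κ hκ q hq (h.weaken hle.2)

/-- A formula outside a maximal stage entails some `q(e₀)`, `q ∈ Q`, together with members of the
stage: otherwise it could be added. -/
theorem Stage.exists_refutation {T : Theory S} {X : S.Srt → Type u} {Γ₀ : List S.Srt}
    {e₀ : Env (Witness S X) Γ₀} {Q : Set (Formula S Γ₀)}
    {m : Set (Σ A, Witness S X A) × Set (PFormula S (Witness S X))}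
    (hm : Maximal (Stage T e₀ Q) m) {Γ : List S.Srt} {e : Env (Witness S X) Γ} (he : e.In m.1)
    {φ : Formula S Γ} (hφ : (⟨Γ, e, φ⟩ : PFormula S (Witness S X)) ∉ m.2) :
    ∃ (Θ : List S.Srt) (u : Env (Witness S X) Θ) (σ : Ren Γ Θ) (κ : Ren Γ₀ Θ) (χ : Formula S Θ),
      u.In m.1 ∧ u.pull σ = e ∧ u.pull κ = e₀ ∧ Der T m.2 u χ ∧
        ∃ q ∈ Q, Provable T (.and χ (φ.ren σ)) (q.ren κ) := by
  by_contra hno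
  refine hφ ((hm.2 (y := (m.1, insert ⟨Γ, e, φ⟩ m.2)) ⟨?_, ?_, ?_⟩
    ⟨le_rfl, Set.subset_insert _ _⟩).2 (Set.mem_insert _ _))
  · rintro x (rfl | hx)
    · exact he
    · exact hm.1.supp x hx
  · exact fun φ e h => Set.mem_insert_of_mem _ (hm.1.henkin φ e h)
  · intro Θ u hu huD κ hκ q hq h
    obtain ⟨Θ', u', ρ, σ, hu', huD', rfl, rfl⟩ := Env.exists_merge m.1 u huD e he
    obtain ⟨χ, hχ, hp⟩ := Der.of_insert hu' σ h.ren
    rw [Formula.ren_ren] at hp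
    exact hno ⟨Θ', u', σ, _, χ, huD', rfl, hκ, hχ, q, hq, hp⟩

theorem Stage.not_der {T : Theory S} {X : S.Srt → Type u} {Γ₀ : List S.Srt}
    {e₀ : Env (Witness S X) Γ₀} {Q : Set (Formula S Γ₀)}
    {m : Set (Σ A, Witness S X A) × Set (PFormula S (Witness S X))}
    (hm : Stage T e₀ Q m) {Θ : List S.Srt} {u : Env (Witness S X) Θ} (hu : u.In m.1)
    {κ : Ren Γ₀ Θ} (hκ : u.pull κ = e₀) {q : Formula S Γ₀} (hq : q ∈ Q) :
    ¬ Der T m.2 u (q.ren κ) := by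
  intro h
  obtain ⟨Θ', u', ρ, -, hu', huD', rfl, -⟩ := Env.exists_merge m.1 u hu u hu
  have := h.ren
  rw [Formula.ren_ren] at this
  exact hm.cons Θ' u' hu' huD' _ hκ q hq this

/-- A maximal stage is deductively closed. -/
theorem Stage.mem_of_der {T : Theory S} {X : S.Srt → Type u} {Γ₀ : List S.Srt}
    {e₀ : Env (Witness S X) Γ₀} {Q : Set (Formula S Γ₀)}
    {m : Set (Σ A, Witness S X A) × Set (PFormula S (Witness S X))}
    (hm : Maximal (Stage T e₀ Q) m) {Γ Δ : List S.Srt} {e : Env (Witness S X) Δ} (he : e.In m.1)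
    {ρ : Ren Γ Δ} {φ : Formula S Γ} (h : Der T m.2 e (φ.ren ρ)) :
    (⟨Γ, e.pull ρ, φ⟩ : PFormula S (Witness S X)) ∈ m.2 := by
  by_contra hφ
  obtain ⟨Θ, u, σ, κ, χ, huD, hσ, hκ, hχ, q, hq, hp⟩ :=
    Stage.exists_refutation hm (fun A v => he A (ρ A v)) hφ
  obtain ⟨Θ', u', α, β, hu', huD', rfl, rfl⟩ := Env.exists_merge m.1 u huD e he
  have hσ' := hu'.ren_eq (ρ := fun A v => α A (σ A v)) (τ := fun A v => β A (ρ A v)) hσ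
  have h₁ := hp.ren α
  have h₂ := h.ren
  rw [Formula.ren_ren] at h₁ h₂
  rw [← hσ', ← Formula.ren_ren] at h₂
  exact hm.1.not_der huD' hκ hq (.mono (.and hχ.ren h₂) h₁)

theorem Stage.mem_or {T : Theory S} {X : S.Srt → Type u} {Γ₀ : List S.Srt}
    {e₀ : Env (Witness S X) Γ₀} {Q : Set (Formula S Γ₀)}
    (hQ : ∀ q ∈ Q, ∀ q' ∈ Q, ∃ q'' ∈ Q, Provable T q q'' ∧ Provable T q' q'')
    {m : Set (Σ A, Witness S X A) × Set (PFormula S (Witness S X))}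
    (hm : Maximal (Stage T e₀ Q) m) {Γ : List S.Srt} {e : Env (Witness S X) Γ} (he : e.In m.1)
    {φ ψ : Formula S Γ} (h : (⟨Γ, e, .or φ ψ⟩ : PFormula S (Witness S X)) ∈ m.2) :
    (⟨Γ, e, φ⟩ : PFormula S (Witness S X)) ∈ m.2 ∨
      (⟨Γ, e, ψ⟩ : PFormula S (Witness S X)) ∈ m.2 := by
  by_contra hno
  obtain ⟨h₁, h₂⟩ := not_or.1 hno
  obtain ⟨Θ₁, u₁, σ₁, κ₁, χ₁, huD₁, hσ₁, hκ₁, hχ₁, q₁, hq₁, hp₁⟩ := Stage.exists_refutation hm he h₁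
  obtain ⟨Θ₂, u₂, σ₂, κ₂, χ₂, huD₂, hσ₂, hκ₂, hχ₂, q₂, hq₂, hp₂⟩ := Stage.exists_refutation hm he h₂
  obtain ⟨q, hq, hqq₁, hqq₂⟩ := hQ q₁ hq₁ q₂ hq₂
  obtain ⟨Θ, u, α, β, hu, huD, rfl, rfl⟩ := Env.exists_merge m.1 u₁ huD₁ u₂ huD₂
  have hσ := hu.ren_eq (ρ := fun A v => α A (σ₁ A v)) (τ := fun A v => β A (σ₂ A v))
    (hσ₁.trans hσ₂.symm)
  have hκ := hu.ren_eq (ρ := fun A v => α A (κ₁ A v)) (τ := fun A v => β A (κ₂ A v))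
    (hκ₁.trans hκ₂.symm)
  have p₁ : Provable T (.and (χ₁.ren α) (φ.ren fun A v => α A (σ₁ A v)))
      (q.ren fun A v => α A (κ₁ A v)) := by
    have := (hp₁.cut (hqq₁.ren κ₁)).ren α
    rw [Formula.ren_ren] at this
    rwa [← Formula.ren_ren φ]
  have p₂ : Provable T (.and (χ₂.ren β) (ψ.ren fun A v => α A (σ₁ A v)))
      (q.ren fun A v => α A (κ₁ A v)) := by
    have := (hp₂.cut (hqq₂.ren κ₂)).ren β
    rw [Formula.ren_ren] at this
    rwa [hσ, hκ, ← Formula.ren_ren ψ]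
  subst hσ₁
  have h' := (Der.self (T := T) h).ren (u := u) (τ := fun A v => α A (σ₁ A v))
  refine hm.1.not_der huD hκ₁ hq (.mono (.and (.and hχ₁.ren hχ₂.ren) h') ?_)
  exact .cut (.distrib _ _ _) (.orElim
    (.cut (.andMono (.andLeft _ _) (.refl _)) p₁) (.cut (.andMono (.andRight _ _) (.refl _)) p₂))

theorem Stage.exists_witness {T : Theory S} {X : S.Srt → Type u} {Γ₀ : List S.Srt}
    {e₀ : Env (Witness S X) Γ₀} {Q : Set (Formula S Γ₀)}
    {m : Set (Σ A, Witness S X A) × Set (PFormula S (Witness S X))}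
    (hm : Maximal (Stage T e₀ Q) m) (he₀ : e₀.In m.1) {Γ : List S.Srt} {A : S.Srt}
    {e : Env (Witness S X) Γ} (he : e.In m.1) {φ : Formula S (A :: Γ)}
    (h : (⟨Γ, e, .ex A φ⟩ : PFormula S (Witness S X)) ∈ m.2) :
    ∃ c, (⟨A, c⟩ : Σ A, Witness S X A) ∈ m.1 ∧
      (⟨A :: Γ, Env.cons c e, φ⟩ : PFormula S (Witness S X)) ∈ m.2 := by
  -- If the formal witness is not yet present, then it can be added without losing consistency.
  by_cases hc : (⟨A, .wit φ e⟩ : Σ A, Witness S X A) ∈ m.1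
  · exact ⟨_, hc, hm.1.henkin φ e hc⟩
  · refine (hc ((hm.2 (y := (insert ⟨A, .wit φ e⟩ m.1,
      insert ⟨A :: Γ, Env.cons (.wit φ e) e, φ⟩ m.2)) ⟨?_, ?_, ?_⟩
      ⟨Set.subset_insert _ _, Set.subset_insert _ _⟩).1 (Set.mem_insert _ _))).elim
    · rintro x (rfl | hx)
      · exact Env.In.cons (Set.mem_insert _ _) (he.mono (Set.subset_insert _ _))
      · exact (hm.1.supp x hx).mono (Set.subset_insert _ _)
    · rintro Γ' A' φ' e' (h' | h')
      · cases h'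
        exact Set.mem_insert _ _
      · exact Set.mem_insert_of_mem _ (hm.1.henkin φ' e' h')
    · intro Θ u hu huD κ hκ q hq hd
      obtain ⟨Θ₁, u₁, τ, σ₂, hu₁, huD₁, hτ, hσ₂⟩ :=
        Env.exists_pull_cons m.1 (.wit φ e) u huD e he
      obtain ⟨Θ', u', α, κ', hu', huD', hα, hκ'⟩ := Env.exists_merge m.1 u₁ huD₁ e₀ he₀
      subst hα hσ₂
      have hτ' : (Env.cons (.wit φ ((u'.pull α).pull σ₂)) u').pull
          (fun B v => α.lift A B (τ B v)) = u := by
        rw [← hτ, ← Env.cons_pull _ u' α]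
      subst hτ'
      have hd' := hd.ren
      rw [Formula.ren_ren] at hd'
      have hi : (Env.cons (Witness.wit φ fun B v => u' B (α B (σ₂ B v))) u').Inj :=
        hu'.cons fun v hv => hc (hv ▸ huD' A v)
      have hκκ := hi.ren_eq (ρ := fun B v => α.lift A B (τ B (κ B v)))
        (τ := fun B v => .there (κ' B v)) (hκ.trans hκ'.symm)
      rw [hκκ] at hd'
      obtain ⟨χ, hχ, hp⟩ := Der.of_insert_fresh hm.1.supp hc hu' huD'
        (fun B v => α B (σ₂ B v)) hd'
      have hex := (Der.self (T := T) h).ren (u := u') (τ := fun B v => α B (σ₂ B v))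
      rw [Formula.ren_ex] at hex
      refine hm.1.not_der huD' hκ' hq (.mono (.and hχ hex) (.cut (.frobenius _ _) (.exElim ?_)))
      refine hp.cut ?_
      change Provable T _ ((q.ren κ').ren fun _ v => .there v)
      rw [Formula.ren_ren]
      exact .refl _

/-! ### Equality and replacement of terms -/

theorem Term.subst_weaken_single {Γ : List S.Srt} {A B : S.Srt} (s : Term S Γ B) (t : Term S Γ A) :
    (s.subst (Subst.weaken S Γ A)).subst (Subst.single t) = s := by
  rw [Term.subst_subst]
  exact s.subst_var

theorem Formula.subst_weaken_single {Γ : List S.Srt} {A : S.Srt} (φ : Formula S Γ)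
    (t : Term S Γ A) : (φ.subst (Subst.weaken S Γ A)).subst (Subst.single t) = φ := by
  rw [Formula.subst_subst]
  exact φ.subst_var

theorem Provable.exOfSubst {T : Theory S} {Γ : List S.Srt} {A : S.Srt} (φ : Formula S (A :: Γ))
    (t : Term S Γ A) : Provable T (φ.subst (Subst.single t)) (.ex A φ) := by
  have := (Provable.exIntro (Provable.refl (T := T) (.ex A φ))).subst (Subst.single t)
  rwa [Formula.subst_weaken_single] at this

theorem Provable.eqSymm {T : Theory S} {Γ : List S.Srt} {A : S.Srt} (s t : Term S Γ A) :
    Provable T (.eq s t) (.eq t s) := by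
  have := Provable.eqSubst (T := T) s t (.eq (.var .here) (s.subst (Subst.weaken S Γ A)))
  simp only [Formula.subst, Term.subst_weaken_single] at this
  exact .cut (.andIntro (.refl _) (.cut (.topIntro _) (.eqRefl s))) this

theorem Provable.eqTrans {T : Theory S} {Γ : List S.Srt} {A : S.Srt} (s t r : Term S Γ A) :
    Provable T (.and (.eq s t) (.eq t r)) (.eq s r) := by
  have := Provable.eqSubst (T := T) t r (.eq (s.subst (Subst.weaken S Γ A)) (.var .here))
  simp only [Formula.subst, Term.subst_weaken_single] at this
  exact .cut (.andIntro (.andRight _ _) (.andLeft _ _)) this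

open Classical in
/-- The substitution `σ`, modified to send the variable `v₀` to `t`. -/
noncomputable def Subst.replace {Γ Δ : List S.Srt} (σ : Subst S Γ Δ) {A : S.Srt} (v₀ : Var Γ A)
    (t : Term S Δ A) : Subst S Γ Δ :=
  fun B v => if h : ∃ h : A = B, h ▸ v₀ = v then h.1 ▸ t else σ B v

theorem Subst.replace_self {Γ Δ : List S.Srt} (σ : Subst S Γ Δ) {A : S.Srt} (v₀ : Var Γ A) :
    σ.replace v₀ (σ A v₀) = σ := by
  funext B v
  unfold Subst.replace
  split
  · rename_i h
    obtain ⟨rfl, rfl⟩ := h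
    rfl
  · rfl

theorem Provable.replace {T : Theory S} {Γ Δ : List S.Srt} (φ : Formula S Γ) (σ : Subst S Γ Δ)
    {A : S.Srt} (v₀ : Var Γ A) (t : Term S Δ A) :
    Provable T (.and (.eq (σ A v₀) t) (φ.subst σ)) (φ.subst (σ.replace v₀ t)) := by
  have key : ∀ s : Term S Δ A, (φ.subst (Subst.replace
      (fun B v => (σ B v).subst (Subst.weaken S Δ A)) v₀ (.var .here))).subst (Subst.single s) =
      φ.subst (σ.replace v₀ s) := by
    intro s
    rw [Formula.subst_subst]
    congr 1
    funext B v
    unfold Subst.replace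
    split
    · rename_i h
      obtain ⟨rfl, rfl⟩ := h
      rfl
    · exact Term.subst_weaken_single _ _
  have := Provable.eqSubst (T := T) (σ A v₀) t (φ.subst (Subst.replace
      (fun B v => (σ B v).subst (Subst.weaken S Δ A)) v₀ (.var .here)))
  rwa [key, key, Subst.replace_self] at this

/-! ### The canonical model -/

/-- The closure properties of a set `G` of formulas with parameters that make it the set of all
formulas true in a model whose elements are named by `D`. -/
structure IsComplete (T : Theory S) {X : S.Srt → Type u} (D : Set (Σ A, X A))
    (G : Set (PFormula S X)) : Prop where
  supp : ∀ x ∈ G, x.2.1.In D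
  closed : ∀ {Γ Δ : List S.Srt} {e : Env X Δ} {ρ : Ren Γ Δ} {φ : Formula S Γ}, e.In D →
    Der T G e (φ.ren ρ) → (⟨Γ, e.pull ρ, φ⟩ : PFormula S X) ∈ G
  bot : ∀ {Γ : List S.Srt} {e : Env X Γ}, (⟨Γ, e, .bot⟩ : PFormula S X) ∉ G
  or : ∀ {Γ : List S.Srt} {e : Env X Γ} {φ ψ : Formula S Γ},
    (⟨Γ, e, .or φ ψ⟩ : PFormula S X) ∈ G →
      (⟨Γ, e, φ⟩ : PFormula S X) ∈ G ∨ (⟨Γ, e, ψ⟩ : PFormula S X) ∈ G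
  ex : ∀ {Γ : List S.Srt} {A : S.Srt} {e : Env X Γ} {φ : Formula S (A :: Γ)},
    (⟨Γ, e, .ex A φ⟩ : PFormula S X) ∈ G →
      ∃ c, (⟨A, c⟩ : Σ A, X A) ∈ D ∧ (⟨A :: Γ, Env.cons c e, φ⟩ : PFormula S X) ∈ G

/-- The element named `c` is the value of the term `t` at `e`, according to `G`. -/
def Rep {X : S.Srt → Type u} (G : Set (PFormula S X)) {Γ : List S.Srt} (e : Env X Γ) {A : S.Srt}
    (t : Term S Γ A) (c : X A) : Prop :=
  (⟨A :: Γ, Env.cons c e, .eq (.var .here) (t.subst (Subst.weaken S Γ A))⟩ : PFormula S X) ∈ G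

/-- The names `c` and `d` denote the same element, according to `G`. -/
def SameName {X : S.Srt → Type u} (G : Set (PFormula S X)) {A : S.Srt} (c d : X A) : Prop :=
  (⟨[A, A], Env.cons c (Env.cons d Env.nil), .eq (.var .here) (.var (.there .here))⟩ :
    PFormula S X) ∈ G

namespace IsComplete

variable {T : Theory S} {X : S.Srt → Type u} {D : Set (Σ A, X A)} {G : Set (PFormula S X)}

theorem mem_of_der (h : IsComplete T D G) {Γ : List S.Srt} {e : Env X Γ} (he : e.In D)
    {φ : Formula S Γ} (hφ : Der T G e φ) : (⟨Γ, e, φ⟩ : PFormula S X) ∈ G :=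
  h.closed (ρ := fun _ v => v) he (by rwa [Formula.ren_id])

theorem mem_ren (h : IsComplete T D G) {Γ Δ : List S.Srt} {e : Env X Δ} (he : e.In D)
    (ρ : Ren Γ Δ) (φ : Formula S Γ) :
    (⟨Γ, e.pull ρ, φ⟩ : PFormula S X) ∈ G ↔ (⟨Δ, e, φ.ren ρ⟩ : PFormula S X) ∈ G :=
  ⟨fun hφ => h.mem_of_der he (Der.self hφ).ren, fun hφ => h.closed he (.self hφ)⟩

theorem mem_mono (h : IsComplete T D G) {Γ : List S.Srt} {e : Env X Γ} {φ ψ : Formula S Γ}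
    (hφ : (⟨Γ, e, φ⟩ : PFormula S X) ∈ G) (hp : Provable T φ ψ) :
    (⟨Γ, e, ψ⟩ : PFormula S X) ∈ G :=
  h.mem_of_der (h.supp _ hφ) (.mono (.self hφ) hp)

theorem mem_and (h : IsComplete T D G) {Γ : List S.Srt} {e : Env X Γ} {φ ψ : Formula S Γ}
    (hφ : (⟨Γ, e, φ⟩ : PFormula S X) ∈ G) (hψ : (⟨Γ, e, ψ⟩ : PFormula S X) ∈ G) :
    (⟨Γ, e, .and φ ψ⟩ : PFormula S X) ∈ G :=
  h.mem_of_der (h.supp _ hφ) (.and (.self hφ) (.self hψ))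

theorem mem_of_top (h : IsComplete T D G) {Γ : List S.Srt} {e : Env X Γ} (he : e.In D)
    {φ : Formula S Γ} (hp : Provable T .top φ) : (⟨Γ, e, φ⟩ : PFormula S X) ∈ G :=
  h.mem_of_der he (.mono .top hp)

theorem sameName_iff (h : IsComplete T D G) {Γ : List S.Srt} {e : Env X Γ} (he : e.In D)
    {A : S.Srt} (v w : Var Γ A) :
    (⟨Γ, e, .eq (.var v) (.var w)⟩ : PFormula S X) ∈ G ↔ SameName G (e A v) (e A w) := by
  have := h.mem_ren he (Ren.cons v (Ren.cons w Ren.nil))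
    (.eq (.var .here) (.var (.there .here)))
  rw [Env.pull_cons, Env.pull_cons, Env.nil_ext (e.pull Ren.nil) Env.nil] at this
  exact this.symm

theorem sameName_refl (h : IsComplete T D G) {A : S.Srt} {c : X A}
    (hc : (⟨A, c⟩ : Σ A, X A) ∈ D) : SameName G c c :=
  have he : (Env.cons c Env.nil).In D := Env.In.cons hc fun _ v => v.nil_elim
  (h.sameName_iff he .here .here).1 (h.mem_of_top he (.eqRefl _))

theorem sameName_symm (h : IsComplete T D G) {A : S.Srt} {c d : X A} (hcd : SameName G c d) :
    SameName G d c :=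
  have he := h.supp _ hcd
  (h.sameName_iff he (.there .here) .here).1 (h.mem_mono hcd (.eqSymm _ _))

theorem sameName_trans (h : IsComplete T D G) {A : S.Srt} {c d b : X A} (hcd : SameName G c d)
    (hdb : SameName G d b) : SameName G c b :=
  have he : (Env.cons c (Env.cons d (Env.cons b Env.nil))).In D :=
    Env.In.cons (h.supp _ hcd _ .here) (h.supp _ hdb)
  (h.sameName_iff he .here (.there (.there .here))).1 (h.mem_mono (h.mem_and
    ((h.sameName_iff he .here (.there .here)).2 hcd)
    ((h.sameName_iff he (.there .here) (.there (.there .here))).2 hdb)) (.eqTrans _ _ _))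

/-- Simultaneous replacement of terms by equal terms. The induction is over a list `Ξ` of variables
off which the two substitutions agree, and replaces one variable at a time. -/
theorem mem_congr_aux (h : IsComplete T D G) {Ξ Γ Δ : List S.Srt} (ι : Ren Ξ Γ) {e : Env X Δ}
    {φ : Formula S Γ} (σ τ : Subst S Γ Δ)
    (hoff : ∀ A v, (∀ w, ι A w ≠ v) → σ A v = τ A v)
    (heq : ∀ A v, (⟨Δ, e, .eq (σ A v) (τ A v)⟩ : PFormula S X) ∈ G)
    (hφ : (⟨Δ, e, φ.subst σ⟩ : PFormula S X) ∈ G) :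
    (⟨Δ, e, φ.subst τ⟩ : PFormula S X) ∈ G := by
  induction Ξ generalizing σ with
  | nil =>
    obtain rfl : σ = τ := funext fun A => funext fun v => hoff A v fun w => w.nil_elim
    exact hφ
  | cons B Ξ ih =>
    have he := h.supp _ hφ
    refine ih (fun _ v => ι _ (.there v)) (σ.replace (ι B .here) (τ B (ι B .here))) ?_ ?_
      (h.mem_mono (h.mem_and (heq _ _) hφ) (.replace _ _ _ _))
    · intro A v hv
      unfold Subst.replace
      split
      · rename_i h
        obtain ⟨rfl, rfl⟩ := h
        rfl
      · rename_i hne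
        refine hoff A v fun w => ?_
        cases w with
        | here => exact fun hw => hne ⟨rfl, hw⟩
        | there w => exact hv w
    · intro A v
      unfold Subst.replace
      split
      · rename_i h'
        obtain ⟨rfl, rfl⟩ := h'
        exact h.mem_of_top he (.eqRefl _)
      · exact heq A v

theorem mem_congr (h : IsComplete T D G) {Γ Δ : List S.Srt} {e : Env X Δ}
    {φ : Formula S Γ} (σ τ : Subst S Γ Δ)
    (heq : ∀ A v, (⟨Δ, e, .eq (σ A v) (τ A v)⟩ : PFormula S X) ∈ G)
    (hφ : (⟨Δ, e, φ.subst σ⟩ : PFormula S X) ∈ G) :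
    (⟨Δ, e, φ.subst τ⟩ : PFormula S X) ∈ G :=
  h.mem_congr_aux (fun _ v => v) σ τ (fun _ v hv => (hv v rfl).elim) heq hφ

/-- The terms of a substitution may be replaced by names of their values. -/
theorem mem_subst (h : IsComplete T D G) {Γ Δ : List S.Srt} {e : Env X Δ} (he : e.In D)
    {c : Env X Γ} (hc : c.In D) {σ : Subst S Γ Δ} (hσ : ∀ A v, Rep G e (σ A v) (c A v))
    (φ : Formula S Γ) :
    (⟨Δ, e, φ.subst σ⟩ : PFormula S X) ∈ G ↔ (⟨Γ, c, φ⟩ : PFormula S X) ∈ G := by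
  obtain ⟨Θ, u, α, β, -, huD, rfl, rfl⟩ := Env.exists_merge D e he c hc
  have heq : ∀ A v, (⟨Θ, u, .eq (.var (β A v)) ((σ A v).subst fun _ w => .var (α _ w))⟩ :
      PFormula S X) ∈ G := by
    intro A v
    have := hσ A v
    unfold Rep at this
    rw [← Env.pull_cons (β A v) u α, h.mem_ren huD] at this
    simp only [Formula.ren, Formula.subst, Term.subst_subst] at this
    exact this
  rw [h.mem_ren huD α, h.mem_ren huD β, Formula.ren, Formula.subst_subst, Formula.ren]
  exact ⟨h.mem_congr _ _ fun A v => h.mem_mono (heq A v) (.eqSymm _ _),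
    h.mem_congr _ _ heq⟩

theorem rep_ren (h : IsComplete T D G) {Γ Δ : List S.Srt} {e : Env X Δ} (he : e.In D)
    (ρ : Ren Γ Δ) {A : S.Srt} {t : Term S Γ A} {c : X A} (hc : (⟨A, c⟩ : Σ A, X A) ∈ D) :
    Rep G (e.pull ρ) t c ↔ Rep G e (t.subst fun _ v => .var (ρ _ v)) c := by
  unfold Rep
  rw [← Env.cons_pull, h.mem_ren (he.cons hc)]
  simp only [Formula.ren, Formula.subst, Term.subst_subst]
  rfl

theorem rep_var (h : IsComplete T D G) {Γ : List S.Srt} {e : Env X Γ} (he : e.In D) {A : S.Srt}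
    (v : Var Γ A) : Rep G e (.var v) (e A v) :=
  (h.sameName_iff (he.cons (he A v)) .here (.there v)).2 (h.sameName_refl (he A v))

theorem exists_rep (h : IsComplete T D G) {Γ : List S.Srt} {e : Env X Γ} (he : e.In D) {A : S.Srt}
    (t : Term S Γ A) : ∃ c, (⟨A, c⟩ : Σ A, X A) ∈ D ∧ Rep G e t c := by
  refine h.ex (h.mem_of_top he (.cut ?_ (.exOfSubst _ t)))
  simp only [Formula.subst, Term.subst_weaken_single]
  exact .eqRefl t

theorem mem_eq_iff (h : IsComplete T D G) {Γ : List S.Srt} {e : Env X Γ} (he : e.In D) {A : S.Srt}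
    {s t : Term S Γ A} {c d : X A} (hc : (⟨A, c⟩ : Σ A, X A) ∈ D) (hd : (⟨A, d⟩ : Σ A, X A) ∈ D)
    (hs : Rep G e s c) (ht : Rep G e t d) :
    (⟨Γ, e, .eq s t⟩ : PFormula S X) ∈ G ↔ SameName G c d := by
  refine h.mem_subst (Γ := [A, A]) (c := Env.cons c (Env.cons d Env.nil))
    (σ := Subst.cons s (Subst.cons t fun _ v => nomatch v)) he
    (Env.In.cons hc (Env.In.cons hd fun _ v => v.nil_elim)) ?_
    (.eq (.var .here) (.var (.there .here)))
  intro B v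
  match v with
  | .here => exact hs
  | .there .here => exact ht

theorem rep_iff (h : IsComplete T D G) {Γ : List S.Srt} {e : Env X Γ} (he : e.In D) {A : S.Srt}
    {t : Term S Γ A} {c d : X A} (hc : (⟨A, c⟩ : Σ A, X A) ∈ D) (hd : (⟨A, d⟩ : Σ A, X A) ∈ D)
    (ht : Rep G e t d) : Rep G e t c ↔ SameName G c d :=
  have he' := he.cons hc
  h.mem_eq_iff he' hc hd (h.rep_var he' .here) ((h.rep_ren he' (fun _ v => .there v) hd).1 ht)

theorem rep_app (h : IsComplete T D G) {Γ As : List S.Srt} {e : Env X Γ} (he : e.In D) {A : S.Srt}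
    (f : S.Fn As A) {ts : ∀ B : S.Srt, Var As B → Term S Γ B} {c : Env X As} (hc : c.In D)
    (hts : ∀ B v, Rep G e (ts B v) (c B v)) {d : X A} (hd : (⟨A, d⟩ : Σ A, X A) ∈ D) :
    Rep G e (.app f ts) d ↔ Rep G c (.app f fun _ v => .var v) d := by
  have he' := he.cons hd
  refine h.mem_subst he' (hc.cons hd) (σ := Subst.lift ts A) ?_
    (.eq (.var .here) (.app f fun _ v => .var (.there v)))
  intro B v
  cases v with
  | here => exact h.rep_var he' .here
  | there v => exact (h.rep_ren he' (fun _ v => .there v) (hc _ v)).1 (hts _ v)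

/-- The identification of names of the same element. -/
def setoid (h : IsComplete T D G) (A : S.Srt) : Setoid {c : X A // (⟨A, c⟩ : Σ A, X A) ∈ D} where
  r c d := SameName G c.1 d.1
  iseqv := ⟨fun c => h.sameName_refl c.2, h.sameName_symm, h.sameName_trans⟩

/-- The sorts of the canonical model: names up to equality. -/
abbrev Carrier (h : IsComplete T D G) (A : S.Srt) : Type u :=
  Quotient (h.setoid A)

theorem sameName_iff_mk (h : IsComplete T D G) {A : S.Srt}
    (c d : {c : X A // (⟨A, c⟩ : Σ A, X A) ∈ D}) :
    SameName G c.1 d.1 ↔ (Quotient.mk _ d : h.Carrier A) = Quotient.mk _ c :=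
  (Quotient.eq (r := h.setoid A)).symm.trans eq_comm

/-- A choice of names for a tuple of elements of the canonical model. -/
noncomputable def names (h : IsComplete T D G) {Γ : List S.Srt} (a : Env h.Carrier Γ) : Env X Γ :=
  fun A v => (a A v).out.1

theorem names_in (h : IsComplete T D G) {Γ : List S.Srt} (a : Env h.Carrier Γ) :
    (h.names a).In D :=
  fun A v => (a A v).out.2

/-- The tuple of elements with given names. -/
def named (h : IsComplete T D G) {Γ : List S.Srt} (e : Env X Γ) (he : e.In D) :
    Env h.Carrier Γ :=
  fun A v => Quotient.mk _ ⟨e A v, he A v⟩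

theorem named_names (h : IsComplete T D G) {Γ : List S.Srt} (a : Env h.Carrier Γ) :
    h.named (h.names a) (h.names_in a) = a :=
  funext fun A => funext fun v => (a A v).out_eq

/-- The canonical model of a complete set of formulas. -/
noncomputable def model (h : IsComplete T D G) : Str S where
  carrier := h.Carrier
  fn f a := Quotient.mk _
    ⟨_, (h.exists_rep (h.names_in a) (.app f fun _ v => .var v)).choose_spec.1⟩
  rl {As} R a := (⟨As, h.names a, .rel R fun _ v => .var v⟩ : PFormula S X) ∈ G

theorem rep_iff_eval (h : IsComplete T D G) {Γ : List S.Srt} {e : Env X Γ} (he : e.In D)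
    {A : S.Srt} (t : Term S Γ A) (c : {c : X A // (⟨A, c⟩ : Σ A, X A) ∈ D}) :
    Rep G e t c.1 ↔ t.eval h.model (h.named e he) = (Quotient.mk _ c : h.Carrier A) := by
  induction t with
  | var v =>
    exact (h.rep_iff he c.2 (he _ v) (h.rep_var he v)).trans
      (h.sameName_iff_mk c ⟨_, he _ v⟩)
  | @app As B f ts ih =>
    let a : Env h.Carrier As := fun B v => (ts B v).eval h.model (h.named e he)
    have hts : ∀ B v, Rep G e (ts B v) (h.names a B v) := fun B v =>
      (ih B v (a B v).out).2 (a B v).out_eq.symm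
    have hd := (h.exists_rep (h.names_in a) (.app f fun _ v => .var v)).choose_spec
    rw [h.rep_app he f (h.names_in a) hts c.2, h.rep_iff (h.names_in a) c.2 hd.1 hd.2]
    exact h.sameName_iff_mk c ⟨_, hd.1⟩

theorem holds_model (h : IsComplete T D G) {Γ : List S.Srt} (φ : Formula S Γ) (e : Env X Γ)
    (he : e.In D) :
    φ.Holds h.model (h.named e he) ↔ (⟨Γ, e, φ⟩ : PFormula S X) ∈ G := by
  induction φ with
  | @rel Γ As R ts =>
    let a : Env h.Carrier As := fun B v => (ts B v).eval h.model (h.named e he)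
    have hts : ∀ B v, Rep G e (ts B v) (h.names a B v) := fun B v =>
      (h.rep_iff_eval he _ (a B v).out).2 (a B v).out_eq.symm
    exact (h.mem_subst he (h.names_in a) hts (.rel R fun _ v => .var v)).symm
  | @eq Γ A s t =>
    let a : h.Carrier A := s.eval h.model (h.named e he)
    let b : h.Carrier A := t.eval h.model (h.named e he)
    refine Iff.symm ((h.mem_eq_iff he a.out.2 b.out.2
      ((h.rep_iff_eval he _ a.out).2 a.out_eq.symm)
      ((h.rep_iff_eval he _ b.out).2 b.out_eq.symm)).trans
      ((Quotient.eq (r := h.setoid _)).symm.trans ?_))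
    rw [Quotient.out_eq, Quotient.out_eq]
    rfl
  | top => exact ⟨fun _ => h.mem_of_top he (.refl _), fun _ => trivial⟩
  | bot => exact ⟨fun h => h.elim, fun hb => (h.bot hb).elim⟩
  | and φ ψ ih₁ ih₂ =>
    refine (and_congr (ih₁ e he) (ih₂ e he)).trans
      ⟨fun h' => h.mem_and h'.1 h'.2, fun h' => ⟨h.mem_mono h' (.andLeft _ _),
        h.mem_mono h' (.andRight _ _)⟩⟩
  | or φ ψ ih₁ ih₂ =>
    refine (or_congr (ih₁ e he) (ih₂ e he)).trans ⟨?_, h.or⟩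
    rintro (h' | h')
    · exact h.mem_mono h' (.orLeft _ _)
    · exact h.mem_mono h' (.orRight _ _)
  | ex A φ ih =>
    have hcons : ∀ c (hc : (⟨A, c⟩ : Σ A, X A) ∈ D),
        h.named (Env.cons c e) (he.cons hc) =
          Env.cons (M := h.Carrier) (Quotient.mk _ ⟨c, hc⟩) (h.named e he) := by
      intro c hc
      funext B v
      cases v <;> rfl
    constructor
    · rintro ⟨m, hm⟩
      obtain ⟨⟨c, hc⟩, rfl⟩ := Quotient.exists_rep m
      have hφ := (ih (Env.cons c e) (he.cons hc)).1 (by rw [hcons c hc]; exact hm)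
      exact (h.mem_ren (he.cons hc) (fun _ v => .there v) (.ex A φ)).2
        (h.mem_mono hφ (.exIntro (.refl _)))
    · intro h'
      obtain ⟨c, hc, hφ⟩ := h.ex h'
      have hm := (ih (Env.cons c e) (he.cons hc)).2 hφ
      rw [hcons c hc] at hm
      exact ⟨_, hm⟩

theorem model_isModel (h : IsComplete T D G) : h.model.IsModel T := by
  intro s hs a ha
  rw [← h.named_names a] at ha ⊢
  rw [h.holds_model] at ha ⊢
  exact h.mem_mono ha (.axm s hs)

end IsComplete

theorem Stage.isComplete {T : Theory S} {X : S.Srt → Type u} {Γ₀ : List S.Srt}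
    {e₀ : Env (Witness S X) Γ₀} {Q : Set (Formula S Γ₀)} (hne : Q.Nonempty)
    (hQ : ∀ q ∈ Q, ∀ q' ∈ Q, ∃ q'' ∈ Q, Provable T q q'' ∧ Provable T q' q'')
    {m : Set (Σ A, Witness S X A) × Set (PFormula S (Witness S X))}
    (hm : Maximal (Stage T e₀ Q) m) (he₀ : e₀.In m.1) : IsComplete T m.1 m.2 where
  supp := hm.1.supp
  closed he h := Stage.mem_of_der hm he h
  bot {Γ e} h := by
    obtain ⟨q, hq⟩ := hne
    obtain ⟨Θ, u, ρ, κ, -, huD, rfl, hκ⟩ := Env.exists_merge m.1 e (hm.1.supp _ h) e₀ he₀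
    exact hm.1.not_der huD hκ hq (.mono (Der.self h).ren (.botElim _))
  or h := Stage.mem_or hQ hm (hm.1.supp _ h) h
  ex h := Stage.exists_witness hm he₀ (hm.1.supp _ h) h

/-- A model existence theorem. Let `G` be a set of formulas with parameters in `X`, and let `Q` be a
directed set of formulas. Suppose that for each tuple `u` of parameters the formulas from `G` at `u`
lie in a deductively closed set `K` avoiding `Q`. Then there is a model of `T` in which `G` is true
and each `q ∈ Q` is false, and in which every false formula is inconsistent with some true formula,
relative to `Q`. -/
theorem exists_model {T : Theory S} {X : S.Srt → Type u} (G : Set (PFormula S X))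
    {Γ₀ : List S.Srt} (e₀ : Env X Γ₀) (Q : Set (Formula S Γ₀)) (hne : Q.Nonempty)
    (hQ : ∀ q ∈ Q, ∀ q' ∈ Q, ∃ q'' ∈ Q, Provable T q q'' ∧ Provable T q' q'')
    (hcons : ∀ (Θ : List S.Srt) (u : Env X Θ), u.Inj → ∀ κ : Ren Γ₀ Θ, u.pull κ = e₀ →
      ∃ K : Formula S Θ → Prop, K .top ∧ (∀ φ ψ, K φ → K ψ → K (.and φ ψ)) ∧
        (∀ φ ψ, K φ → Provable T φ ψ → K ψ) ∧
        (∀ (Γ : List S.Srt) (φ : Formula S Γ) (σ : Ren Γ Θ),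
          (⟨Γ, u.pull σ, φ⟩ : PFormula S X) ∈ G → K (φ.ren σ)) ∧
        ∀ q ∈ Q, ¬ K (q.ren κ)) :
    ∃ (N : Str S) (f : ∀ A, X A → N.carrier A), N.IsModel T ∧
      (∀ (Γ : List S.Srt) (e : Env X Γ) (φ : Formula S Γ), (⟨Γ, e, φ⟩ : PFormula S X) ∈ G →
        φ.Holds N fun A v => f A (e A v)) ∧
      (∀ q ∈ Q, ¬ q.Holds N fun A v => f A (e₀ A v)) ∧
      ∀ (Γ : List S.Srt) (φ : Formula S Γ) (b : Env N.carrier Γ), ¬ φ.Holds N b →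
        ∃ (Θ : List S.Srt) (w : Env N.carrier Θ) (σ : Ren Γ Θ) (κ : Ren Γ₀ Θ) (χ : Formula S Θ),
          w.pull σ = b ∧ χ.Holds N w ∧ ∃ q ∈ Q, Provable T (.and χ (φ.ren σ)) (q.ren κ) := by
  let ι : ∀ {Γ : List S.Srt}, Env X Γ → Env (Witness S X) Γ := fun e A v => .base (e A v)
  have hι : ∀ {Γ : List S.Srt} {e e' : Env X Γ}, ι e = ι e' → e = e' := fun h =>
    funext fun A => funext fun v => Witness.base.inj (congrFun (congrFun h A) v)
  let p : Set (Σ A, Witness S X A) × Set (PFormula S (Witness S X)) :=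
    ({x | ∃ y, x.2 = .base y}, {x | ∃ e : Env X x.1, x.2.1 = ι e ∧
      (⟨x.1, e, x.2.2⟩ : PFormula S X) ∈ G})
  have hp : Stage T (ι e₀) Q p := by
    refine ⟨?_, ?_, ?_⟩
    · rintro ⟨Γ, e, φ⟩ ⟨e', he, h⟩ A v
      exact ⟨e' A v, congrFun (congrFun he A) v⟩
    · rintro Γ A φ e ⟨y, hy⟩
      cases hy
    · intro Θ u hu huD κ hκ q hq hd
      obtain ⟨u', rfl⟩ : ∃ u', u = ι u' := by
        choose u' hu' using huD
        exact ⟨u', funext fun A => funext fun v => hu' A v⟩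
      obtain ⟨K, h₁, h₂, h₃, h₄, h₅⟩ := hcons Θ u'
        (fun A v w h => hu A v w (congrArg Witness.base h)) κ (hι hκ)
      refine h₅ q hq ?_
      generalize q.ren κ = ξ at hd ⊢
      induction hd with
      | base φ σ h =>
        obtain ⟨e, he, h⟩ := h
        obtain rfl := hι (e := u'.pull σ) he
        exact h₄ _ φ σ h
      | top => exact h₁
      | and _ _ ih₁ ih₂ => exact h₂ _ _ ih₁ ih₂
      | mono _ h ih => exact h₃ _ _ ih h
  obtain ⟨m, hpm, hm⟩ := hp.exists_maximal
  have hX : ∀ {Γ : List S.Srt} (e : Env X Γ), (ι e).In m.1 := fun e A v => hpm.1 ⟨_, rfl⟩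
  have h := Stage.isComplete hne hQ hm (hX e₀)
  refine ⟨h.model, fun A x => Quotient.mk _ ⟨.base x, hpm.1 ⟨x, rfl⟩⟩, h.model_isModel, ?_, ?_, ?_⟩
  · intro Γ e φ hφ
    exact (h.holds_model φ (ι e) (hX e)).2 (hpm.2 ⟨e, rfl, hφ⟩)
  · intro q hq hφ
    have := (h.holds_model q (ι e₀) (hX e₀)).1 hφ
    refine hm.1.not_der (hX e₀) (κ := fun _ v => v) rfl hq ?_
    rw [Formula.ren_id]
    exact .self this
  · intro Γ φ b hb
    rw [← h.named_names b, h.holds_model] at hb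
    obtain ⟨Θ, u, σ, κ, χ, huD, hσ, -, hχ, q, hq, hpr⟩ :=
      Stage.exists_refutation hm (h.names_in b) hb
    refine ⟨Θ, h.named u huD, σ, κ, χ, ?_, (h.holds_model χ u huD).2 (h.mem_of_der huD hχ),
      q, hq, hpr⟩
    rw [← h.named_names b]
    funext A v
    simp only [IsComplete.named, ← hσ]
    rfl

/-! ### Completeness, diagrams and existentially closed models -/

/-- Completeness in the form that also gives compactness: a directed set of formulas, none of which
follows from `φ`, is refuted by a single tuple satisfying `φ`. -/
theorem exists_model_of_not_provable {T : Theory S} {Γ : List S.Srt} (φ : Formula S Γ)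
    (Q : Set (Formula S Γ)) (hne : Q.Nonempty)
    (hQ : ∀ q ∈ Q, ∀ q' ∈ Q, ∃ q'' ∈ Q, Provable T q q'' ∧ Provable T q' q'')
    (h : ∀ q ∈ Q, ¬ Provable T φ q) :
    ∃ N : Str S, N.IsModel T ∧ ∃ a : Env N.carrier Γ, φ.Holds N a ∧ ∀ q ∈ Q, ¬ q.Holds N a := by
  -- The parameters are the variables of `Γ`, so that a tuple of parameters is a renaming.
  obtain ⟨N, f, hN, hG, hq, -⟩ := exists_model (T := T) (X := fun A => Var Γ A)
    {⟨Γ, fun _ v => v, φ⟩} (fun _ v => v) Q hne hQ (by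
      intro Θ u hu κ hκ
      refine ⟨fun ξ => Provable T φ (ξ.ren u), .topIntro _, fun _ _ h₁ h₂ => .andIntro h₁ h₂,
        fun _ _ h₁ h₂ => .cut h₁ (h₂.ren u), ?_, ?_⟩
      · intro Δ ψ σ hψ
        obtain rfl : Δ = Γ := congrArg Sigma.fst hψ
        have h' := Prod.mk.inj (eq_of_heq (Sigma.mk.inj hψ).2)
        have hσ : (fun A v => u A (σ A v)) = fun _ v => v := h'.1
        rw [Formula.ren_ren, hσ, Formula.ren_id, h'.2]
        exact .refl _
      · intro q hq hK
        rw [Formula.ren_ren] at hK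
        have : (fun A v => u A (κ A v)) = fun _ v => v := hκ
        rw [this, Formula.ren_id] at hK
        exact h q hq hK)
  exact ⟨N, hN, _, hG _ _ _ rfl, hq⟩

/-- Soundness and completeness of coherent logic. -/
theorem provable_iff {T : Theory S} {Γ : List S.Srt} {φ ψ : Formula S Γ} :
    Provable T φ ψ ↔
      ∀ N : Str S, N.IsModel T → ∀ a : Env N.carrier Γ, φ.Holds N a → ψ.Holds N a := by
  refine ⟨fun h N hN a => h.sound hN a, fun h => ?_⟩
  by_contra hno
  obtain ⟨N, hN, a, hφ, hψ⟩ := exists_model_of_not_provable φ {ψ} ⟨ψ, rfl⟩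
    (by rintro _ rfl _ rfl; exact ⟨_, rfl, .refl _, .refl _⟩)
    (by rintro _ rfl; exact hno)
  exact hψ ψ rfl (h N hN a hφ)

/-- The method of diagrams: if no homomorphism from `M` to a model of `T` makes `φ` true and `q`
false at the tuple `b`, then a formula true of `b` in `M` proves that `φ` implies `q`. -/
theorem exists_hom_or_provable (T : Theory S) (M : Str S) {Γ : List S.Srt} (b : Env M.carrier Γ)
    (φ q : Formula S Γ) :
    (∃ N : Str S, N.IsModel T ∧ ∃ h : Hom M N, φ.Holds N (h.onEnv b) ∧ ¬ q.Holds N (h.onEnv b)) ∨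
      ∃ α : Formula S Γ, α.Holds M b ∧ Provable T (.and α φ) q := by
  refine or_iff_not_imp_right.2 fun hno => ?_
  obtain ⟨N, f, hN, hG, hq, -⟩ := exists_model (T := T) (X := M.carrier)
    (insert ⟨Γ, b, φ⟩ {x | x.2.2.Holds M x.2.1}) b {q} ⟨q, rfl⟩
    (by rintro _ rfl _ rfl; exact ⟨_, rfl, .refl _, .refl _⟩) (by
      intro Θ u hu κ hκ
      refine ⟨fun ξ => ∃ α : Formula S Θ, α.Holds M u ∧ Provable T (.and α (φ.ren κ)) ξ,
        ⟨.top, trivial, .topIntro _⟩, ?_, fun _ _ ⟨α, hα, h₁⟩ h₂ => ⟨α, hα, .cut h₁ h₂⟩, ?_, ?_⟩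
      · rintro ψ ψ' ⟨α, hα, h⟩ ⟨α', hα', h'⟩
        exact ⟨.and α α', ⟨hα, hα'⟩, .andIntro (.cut (.andMono (.andLeft _ _) (.refl _)) h)
          (.cut (.andMono (.andRight _ _) (.refl _)) h')⟩
      · rintro Δ ψ σ (hψ | hψ)
        · obtain rfl : Δ = Γ := congrArg Sigma.fst hψ
          have h' := Prod.mk.inj (eq_of_heq (Sigma.mk.inj hψ).2)
          obtain rfl := hu.ren_eq (h'.1.trans hκ.symm)
          obtain rfl := h'.2
          exact ⟨.top, trivial, .andRight _ _⟩
        · exact ⟨ψ.ren σ, (Formula.holds_ren M ψ σ u).2 hψ, .andLeft _ _⟩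
      · rintro _ rfl ⟨α, hα, h⟩
        refine hno ⟨α.image κ, (Formula.holds_image M κ α b).2 ⟨u, hα, hκ⟩, ?_⟩
        rw [provable_iff] at h ⊢
        rintro N hN a ⟨ha, hφ⟩
        obtain ⟨w, hw, rfl⟩ := (Formula.holds_image N κ α a).1 ha
        exact (Formula.holds_ren N _ κ w).1 (h N hN w ⟨hw, (Formula.holds_ren N φ κ w).2 hφ⟩))
  exact ⟨N, hN, Hom.ofHolds f fun Δ ψ a h => hG Δ a ψ (Or.inr h), hG Γ b φ (Or.inl rfl), hq q rfl⟩

theorem exists_existentiallyClosed {T : Theory S} {M : Str S} (hM : M.IsModel T) :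
    ∃ N : Str S, IsExistentiallyClosed T N ∧ Nonempty (Hom M N) := by
  obtain ⟨N, f, hN, hG, -, hec⟩ := exists_model (T := T) (X := M.carrier)
    {x | x.2.2.Holds M x.2.1} (Γ₀ := []) Env.nil {.bot} ⟨_, rfl⟩
    (by rintro _ rfl _ rfl; exact ⟨_, rfl, .refl _, .refl _⟩) (by
      intro Θ u hu κ hκ
      refine ⟨fun ξ => ξ.Holds M u, trivial, fun _ _ h h' => ⟨h, h'⟩,
        fun _ _ h h' => h'.sound hM u h,
        fun Γ φ σ h => (Formula.holds_ren M φ σ u).2 h, ?_⟩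
      rintro _ rfl h
      exact h)
  refine ⟨N, ⟨hN, fun N' hN' h Γ φ a => ⟨h.holds φ a, fun hφ => ?_⟩⟩,
    ⟨Hom.ofHolds f fun Γ φ a h => hG Γ a φ h⟩⟩
  by_contra hno
  obtain ⟨Θ, w, σ, κ, χ, rfl, hχ, q, rfl, hp⟩ := hec Γ φ a hno
  exact hp.sound hN' (h.onEnv w) ⟨h.holds χ w hχ, (Formula.holds_ren N' φ σ _).2 hφ⟩

/-- In an existentially closed model, a false formula is refuted by a true one. -/
theorem IsExistentiallyClosed.exists_refutation {T : Theory S} {E : Str S}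
    (hE : IsExistentiallyClosed T E) {Γ : List S.Srt} {φ : Formula S Γ} {b : Env E.carrier Γ}
    (hφ : ¬ φ.Holds E b) : ∃ α : Formula S Γ, α.Holds E b ∧ Provable T (.and φ α) .bot := by
  rcases exists_hom_or_provable T E b φ .bot with ⟨N, hN, h, hN', -⟩ | ⟨α, hα, hp⟩
  · exact (hφ ((hE.2 N hN h Γ φ b).2 hN')).elim
  · exact ⟨α, hα, .cut (.andIntro (.andRight _ _) (.andLeft _ _)) hp⟩

theorem Str.IsModel.of_provable {T T' : Theory S} (h : ∀ s ∈ T, Provable T' s.lhs s.rhs)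
    {M : Str S} (hM : M.IsModel T') : M.IsModel T :=
  fun s hs a => (h s hs).sound hM a

theorem IsExistentiallyClosed.isModel_ecTheory {T : Theory S} {E : Str S}
    (hE : IsExistentiallyClosed T E) : E.IsModel (ecTheory T) :=
  fun _ hs => hs E hE

theorem provable_ecTheory {T : Theory S} : ∀ s ∈ T, Provable (ecTheory T) s.lhs s.rhs :=
  fun s hs => .axm s fun _ hE => hE.1 s hs

theorem modelConsistent_ecTheory (T : Theory S) : ModelConsistent (ecTheory T) T := by
  intro M hM
  obtain ⟨N, hN, h⟩ := exists_existentiallyClosed hM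
  exact ⟨N, hN.isModel_ecTheory, h⟩

/-! ### De Morgan's law and strong invariance -/

theorem DeMorganAt.stronglyInvariant {T : Theory S} {Γ : List S.Srt} {φ : Formula S Γ}
    (h : DeMorganAt T φ) : StronglyInvariant (ecTheory T) T φ := by
  obtain ⟨ψ, θ, hψ, hθ, hor⟩ := h
  have hφψ := (hψ ψ).1 (.refl _)
  have hψθ := (hθ θ).1 (.refl _)
  -- `φ**` implies `φ` in existentially closed models, as a formula refuting `φ` there implies `φ*`.
  have hθφ : Provable (ecTheory T) θ φ := by
    refine .axm ⟨Γ, θ, φ⟩ fun E hE b hb => ?_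
    by_contra hno
    obtain ⟨α, hα, hp⟩ := hE.exists_refutation hno
    exact hψθ.sound hE.1 b ⟨((hψ α).2 hp).sound hE.1 b hα, hb⟩
  intro M M₁ M₂ hM h₁ h₂ k₁ k₂ a
  rcases hor.sound hM a trivial with ha | ha
  · have key : ∀ N : Str S, N.IsModel (ecTheory T) → ∀ k : Hom M N, ¬ φ.Holds N (k.onEnv a) :=
      fun N hN k hφ => hφψ.sound (hN.of_provable provable_ecTheory) _ ⟨hφ, k.holds ψ a ha⟩
    exact iff_of_false (key M₁ h₁ k₁) (key M₂ h₂ k₂)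
  · exact iff_of_true (hθφ.sound h₁ _ (k₁.holds θ a ha)) (hθφ.sound h₂ _ (k₂.holds θ a ha))

/-- By compactness, strong invariance of `φ` splits the models of `T` into a finite number of
cases, in each of which `T'` proves or refutes `φ`. The disjunctions of the cases of either kind are
the pseudo-complements `φ**` and `φ*`. -/
theorem StronglyInvariant.deMorganAt {T T' : Theory S} (hT : ∀ s ∈ T, Provable T' s.lhs s.rhs)
    (hc : ModelConsistent T' T) {Γ : List S.Srt} {φ : Formula S Γ}
    (h : StronglyInvariant T' T φ) : DeMorganAt T φ := by
  obtain ⟨ψ, χ, hψ, hχ, hor⟩ : ∃ ψ χ : Formula S Γ, Provable T' ψ φ ∧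
      Provable T' (.and φ χ) .bot ∧ Provable T .top (.or χ ψ) := by
    by_contra hno
    obtain ⟨M, hM, a, -, ha⟩ := exists_model_of_not_provable (T := T) (Γ := Γ) .top
      {q | ∃ ψ χ : Formula S Γ, Provable T' ψ φ ∧ Provable T' (.and φ χ) .bot ∧ q = .or χ ψ}
      ⟨_, .bot, .bot, .botElim _, .andRight _ _, rfl⟩ (by
        rintro _ ⟨ψ, χ, hψ, hχ, rfl⟩ _ ⟨ψ', χ', hψ', hχ', rfl⟩
        exact ⟨_, ⟨.or ψ ψ', .or χ χ', .orElim hψ hψ', .cut (.distrib _ _ _) (.orElim hχ hχ'), rfl⟩,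
          .orElim (.cut (.orLeft _ _) (.orLeft _ _)) (.cut (.orLeft _ _) (.orRight _ _)),
          .orElim (.cut (.orRight _ _) (.orLeft _ _)) (.cut (.orRight _ _) (.orRight _ _))⟩) (by
        rintro _ ⟨ψ, χ, hψ, hχ, rfl⟩ hp
        exact hno ⟨ψ, χ, hψ, hχ, hp⟩)
    rcases exists_hom_or_provable T' M a .top φ with ⟨M₁, hM₁, k₁, -, hk₁⟩ | ⟨α, hα, hp⟩
    · rcases exists_hom_or_provable T' M a φ .bot with ⟨M₂, hM₂, k₂, hk₂, -⟩ | ⟨α, hα, hp⟩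
      · exact hk₁ ((h M M₁ M₂ hM hM₁ hM₂ k₁ k₂ a).2 hk₂)
      · exact ha (.or α .bot) ⟨.bot, α, .botElim _,
          .cut (.andIntro (.andRight _ _) (.andLeft _ _)) hp, rfl⟩ (Or.inl hα)
    · exact ha (.or .bot α) ⟨α, .bot, .cut (.andIntro (.refl _) (.topIntro _)) hp,
        .andRight _ _, rfl⟩ (Or.inr hα)
  -- By relative model consistency, `T` and `T'` prove the same formulas inconsistent.
  have hcons : ∀ ξ : Formula S Γ, Provable T' ξ .bot → Provable T ξ .bot := by
    intro ξ hξ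
    rw [provable_iff]
    intro M hM a ha
    obtain ⟨N, hN, ⟨k⟩⟩ := hc M hM
    exact hξ.sound hN _ (k.holds ξ a ha)
  have hlift : ∀ {α β : Formula S Γ}, Provable T α β → Provable T' α β := fun hp =>
    provable_iff.2 fun N hN a => hp.sound (hN.of_provable hT) a
  have hχψ : Provable T (.and χ ψ) .bot := hcons _ (.cut (.andIntro
    (.cut (.andRight _ _) hψ) (.andLeft _ _)) hχ)
  refine ⟨χ, ψ, fun ξ => ⟨fun hξ => hcons _ (.cut (.andMono (.refl _) (hlift hξ)) hχ),
      fun hξ => ?_⟩,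
    fun ξ => ⟨fun hξ => .cut (.andMono (.refl _) hξ) hχψ, fun hξ => ?_⟩, hor⟩
  · have hξψ : Provable T (.and ξ ψ) .bot := hcons _ (.cut (.andIntro
      (.cut (.andRight _ _) hψ) (.andLeft _ _)) (hlift hξ))
    rw [provable_iff] at hor hξψ ⊢
    exact fun N hN a ha => (hor N hN a trivial).resolve_right fun hb => hξψ N hN a ⟨ha, hb⟩
  · rw [provable_iff] at hor hξ ⊢
    exact fun N hN a ha => (hor N hN a trivial).resolve_left fun hb => hξ N hN a ⟨hb, ha⟩

/-! ### Amalgamation -/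

/-- Homomorphisms `h₁ : M → M₁` and `g : M → E` amalgamate if every formula true in `M₁` of a tuple
from `M` is also true in `E`. -/
theorem exists_amalgam {T : Theory S} {M M₁ E : Str S} (hE : E.IsModel T) (h₁ : Hom M M₁)
    (g : Hom M E) (hle : ∀ (Γ : List S.Srt) (φ : Formula S Γ) (a : Env M.carrier Γ),
      φ.Holds M₁ (h₁.onEnv a) → φ.Holds E (g.onEnv a)) :
    ∃ N : Str S, N.IsModel T ∧ ∃ (k₁ : Hom M₁ N) (k₂ : Hom E N),
      ∀ (A : S.Srt) (x : M.carrier A), k₁.map A (h₁.map A x) = k₂.map A (g.map A x) := by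
  let X : S.Srt → Type u := fun A => M₁.carrier A ⊕ E.carrier A
  let G₁ : Set (PFormula S X) :=
    {x | ∃ b : Env M₁.carrier x.1, x.2.1 = (fun A v => .inl (b A v)) ∧ x.2.2.Holds M₁ b}
  let G₂ : Set (PFormula S X) :=
    {x | ∃ c : Env E.carrier x.1, x.2.1 = (fun A v => .inr (c A v)) ∧ x.2.2.Holds E c}
  let G₃ : Set (PFormula S X) :=
    {x | ∃ (A : S.Srt) (m : M.carrier A), x = ⟨[A, A], Env.cons (.inl (h₁.map A m))
      (Env.cons (.inr (g.map A m)) Env.nil), .eq (.var .here) (.var (.there .here))⟩}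
  obtain ⟨N, f, hN, hG, -, -⟩ := exists_model (T := T) (X := X) (G₁ ∪ G₂ ∪ G₃) (Γ₀ := []) Env.nil
    {.bot} ⟨_, rfl⟩ (by rintro _ rfl _ rfl; exact ⟨_, rfl, .refl _, .refl _⟩) (by
      intro Θ u hu κ hκ
      obtain ⟨Θ₁, ρ, hρ, hρ₁, hρ₂⟩ := Ren.exists_subcontext (Θ := Θ) fun A v => ∃ x, u A v = .inl x
      choose b hb using hρ₁
      -- An interpretation of the parameters in `E` that is the identity on `E` and is `g` on `M`.
      let Good : Env E.carrier Θ → Prop := fun w => ∀ A v,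
        (∀ y, u A v = .inr y → w A v = y) ∧ ∀ m, u A v = .inl (h₁.map A m) → w A v = g.map A m
      refine ⟨fun ξ => ∃ φ : Formula S Θ₁, φ.Holds M₁ b ∧
        ∀ w, Good w → φ.Holds E (w.pull ρ) → ξ.Holds E w, ⟨.top, trivial, fun _ _ _ => trivial⟩,
        ?_, ?_, ?_, ?_⟩
      · rintro ψ ψ' ⟨φ, hφ, h⟩ ⟨φ', hφ', h'⟩
        exact ⟨.and φ φ', ⟨hφ, hφ'⟩, fun w hw hh => ⟨h w hw hh.1, h' w hw hh.2⟩⟩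
      · rintro ψ ψ' ⟨φ, hφ, h⟩ hp
        exact ⟨φ, hφ, fun w hw hh => hp.sound hE w (h w hw hh)⟩
      · rintro Γ ψ σ ((⟨b', hb', hψ⟩ | ⟨c, hc, hψ⟩) | ⟨A, m, hm⟩)
        · have hb'' : ∀ A v, u A (σ A v) = .inl (b' A v) := fun A v =>
            congrFun (congrFun hb' A) v
          choose τ hτ using fun A v => hρ₂ A (σ A v) ⟨_, hb'' A v⟩
          have hbτ : (fun A v => b A (τ A v)) = b' := by
            funext A v
            have := hb A (τ A v)
            rw [hτ, hb''] at this
            exact (Sum.inl.inj this).symm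
          refine ⟨ψ.ren τ, (Formula.holds_ren _ _ _ _).2 (by rw [hbτ]; exact hψ),
            fun w _ h => ?_⟩
          rw [Formula.holds_ren] at h ⊢
          simpa only [Env.pull, hτ] using h
        · refine ⟨.top, trivial, fun w hw _ => ?_⟩
          rw [Formula.holds_ren]
          have : w.pull σ = c := funext fun A => funext fun v =>
            (hw A (σ A v)).1 _ (congrFun (congrFun hc A) v)
          change ψ.Holds E (w.pull σ)
          rwa [this]
        · obtain rfl : Γ = [A, A] := congrArg Sigma.fst hm
          have h' := Prod.mk.inj (eq_of_heq (Sigma.mk.inj hm).2)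
          obtain rfl : ψ = _ := h'.2
          refine ⟨.top, trivial, fun w hw _ => ?_⟩
          change w A (σ A .here) = w A (σ A (.there .here))
          rw [(hw A _).2 m (congrFun (congrFun h'.1 A) .here),
            (hw A _).1 _ (congrFun (congrFun h'.1 A) (.there .here))]
      · rintro _ rfl ⟨φ, hφ, h⟩
        -- Transfer to `E` the statement that the part of `b` from `M` extends to a solution of `φ`.
        obtain ⟨Γ, σ, -, hσ₁, hσ₂⟩ := Ren.exists_subcontext (Θ := Θ₁)
          fun A v => ∃ m, b A v = h₁.map A m
        choose a ha using hσ₁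
        have hab : Env.pull b σ = h₁.onEnv a := funext fun A => funext fun v => ha A v
        obtain ⟨w₁, hw₁, hwa⟩ := (Formula.holds_image E σ φ _).1
          (hle Γ (φ.image σ) a ((Formula.holds_image M₁ σ φ _).2 ⟨b, hφ, hab⟩))
        have hwa' : ∀ A v, w₁ A (σ A v) = g.map A (a A v) := fun A v =>
          congrFun (congrFun hwa A) v
        have hex : ∀ A v, ∃ z : E.carrier A, (∀ y, u A v = .inr y → z = y) ∧
            ∀ v₁, ρ A v₁ = v → z = w₁ A v₁ := by
          intro A v
          rcases hx : u A v with x | y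
          · obtain ⟨v₁, rfl⟩ := hρ₂ A v ⟨x, hx⟩
            exact ⟨w₁ A v₁, fun y hy => (Sum.inl_ne_inr hy).elim, fun v₂ h₂ => by rw [hρ _ _ _ h₂]⟩
          · refine ⟨y, fun y' hy => Sum.inr.inj hy, ?_⟩
            rintro v₁ rfl
            rw [hb] at hx
            cases hx
        choose w hw hwρ using hex
        refine h w (fun A v => ⟨hw A v, fun m hm => ?_⟩) ?_
        · obtain ⟨v₁, rfl⟩ := hρ₂ A v ⟨_, hm⟩
          rw [hwρ A _ v₁ rfl]
          have hbm : b A v₁ = h₁.map A m := by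
            rw [hb] at hm
            exact Sum.inl.inj hm
          obtain ⟨v₂, rfl⟩ := hσ₂ A v₁ ⟨m, hbm⟩
          rw [hwa']
          -- `h₁` may identify elements of `M`; the formula `x = y` shows that `g` does so as well.
          rw [ha] at hbm
          exact hle [A, A] (.eq (.var .here) (.var (.there .here)))
            (Env.cons (a A v₂) (Env.cons m Env.nil)) hbm
        · have : Env.pull w ρ = w₁ := funext fun A => funext fun v => hwρ A _ v rfl
          rw [this]
          exact hw₁)
  refine ⟨N, hN,
    Hom.ofHolds (fun A x => f A (.inl x)) fun Γ φ b h => hG Γ _ φ (Or.inl (Or.inl ⟨b, rfl, h⟩)),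
    Hom.ofHolds (fun A x => f A (.inr x)) fun Γ φ c h => hG Γ _ φ (Or.inl (Or.inr ⟨c, rfl, h⟩)),
    fun A x => hG [A, A] _ _ (Or.inr ⟨A, x, rfl⟩)⟩

theorem DeMorganCoherent.modelComplete {T : Theory S} (h : DeMorganCoherent T) :
    ModelComplete (ecTheory T) T :=
  fun M M₁ M₂ hM h₁ h₂ k₁ k₂ Γ φ a => (h Γ φ).stronglyInvariant M M₁ M₂ hM h₁ h₂ k₁ k₂ a

theorem DeMorganCoherent.amalgamation {T : Theory S} (h : DeMorganCoherent T) :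
    Amalgamation T := by
  intro M M₁ M₂ hM hM₁ hM₂ h₁ h₂
  obtain ⟨E₁, hE₁, ⟨k₁⟩⟩ := exists_existentiallyClosed hM₁
  obtain ⟨E₂, hE₂, ⟨k₂⟩⟩ := exists_existentiallyClosed hM₂
  obtain ⟨N, hN, l₁, l₂, hl⟩ := exists_amalgam hE₂.1 h₁ (h₂.comp k₂) fun Γ φ a hφ =>
    (h.modelComplete M E₁ E₂ hM hE₁.isModel_ecTheory hE₂.isModel_ecTheory (h₁.comp k₁)
      (h₂.comp k₂) Γ φ a).1 (k₁.holds φ _ hφ)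
  exact ⟨N, hN, l₁, k₂.comp l₂, hl⟩

/-! ### Model completions and model companions -/

theorem DeMorganCoherent.isModelCompletion {T : Theory S} (h : DeMorganCoherent T) :
    IsModelCompletion (ecTheory T) T :=
  ⟨provable_ecTheory, modelConsistent_ecTheory T, h.modelComplete⟩

theorem IsModelCompletion.deMorganCoherent {T T' : Theory S} (h : IsModelCompletion T' T) :
    DeMorganCoherent T := fun Γ φ =>
  StronglyInvariant.deMorganAt h.1 h.2.1 fun M M₁ M₂ hM h₁ h₂ k₁ k₂ a =>
    h.2.2 M M₁ M₂ hM h₁ h₂ k₁ k₂ Γ φ a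

theorem IsModelCompletion.isModelCompanion {T T' : Theory S} (h : IsModelCompletion T' T) :
    IsModelCompanion T' T :=
  ⟨h.2.1, fun M hM => ⟨M, hM.of_provable h.1, ⟨Hom.id M⟩⟩,
    fun M M₁ M₂ hM => h.2.2 M M₁ M₂ (hM.of_provable h.1)⟩

theorem ModelComplete.holds_iff {T : Theory S} (h : ModelComplete T T) {M N : Str S}
    (hM : M.IsModel T) (hN : N.IsModel T) (k : Hom M N) {Γ : List S.Srt} (φ : Formula S Γ)
    (a : Env M.carrier Γ) : φ.Holds M a ↔ φ.Holds N (k.onEnv a) :=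
  h M M N hM hM hN (Hom.id M) k Γ φ a

/-- A model `M` of the model companion maps to a model of `T` and on to a model of the companion.
The composite reflects coherent formulas, so `M` satisfies the axioms of `T`. -/
theorem IsModelCompanion.isModel {T T' : Theory S} (h : IsModelCompanion T' T) {M : Str S}
    (hM : M.IsModel T') : M.IsModel T := by
  intro s hs a ha
  obtain ⟨N, hN, ⟨k⟩⟩ := h.2.1 M hM
  obtain ⟨M', hM', ⟨l⟩⟩ := h.1 N hN
  exact (h.2.2.holds_iff hM hM' (k.comp l) s.rhs a).2
    (l.holds _ _ (hN s hs _ (k.holds _ a ha)))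

theorem IsModelCompanion.isModelCompletion {T T' : Theory S} (h : IsModelCompanion T' T)
    (hT : Amalgamation T) : IsModelCompletion T' T := by
  refine ⟨fun s hs => provable_iff.2 fun N hN => h.isModel hN s hs, h.1, ?_⟩
  intro M M₁ M₂ hM h₁ h₂ k₁ k₂ Γ φ a
  obtain ⟨N, hN, l₁, l₂, hl⟩ := hT M M₁ M₂ hM (h.isModel h₁) (h.isModel h₂) k₁ k₂
  obtain ⟨N', hN', ⟨l⟩⟩ := h.1 N hN
  rw [h.2.2.holds_iff h₁ hN' (l₁.comp l) φ, h.2.2.holds_iff h₂ hN' (l₂.comp l) φ]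
  have : (l₁.comp l).onEnv (k₁.onEnv a) = (l₂.comp l).onEnv (k₂.onEnv a) :=
    funext fun A => funext fun v => congrArg (l.map A) (hl A (a A v))
  rw [this]

end CoherentLogic

theorem mainTheorem4 (S : CoherentLogic.Signature.{u}) (T : CoherentLogic.Theory S) :
    (CoherentLogic.DeMorganCoherent T ↔
      ∃ T' : CoherentLogic.Theory S, CoherentLogic.IsModelCompletion T' T) ∧
    (CoherentLogic.DeMorganCoherent T ↔
      (∃ T' : CoherentLogic.Theory S, CoherentLogic.IsModelCompanion T' T) ∧
        CoherentLogic.Amalgamation T) ∧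
    (∀ (Γ : List S.Srt) (φ : CoherentLogic.Formula S Γ),
      CoherentLogic.DeMorganAt T φ ↔
        CoherentLogic.StronglyInvariant (CoherentLogic.ecTheory T) T φ) :=
  ⟨⟨fun h => ⟨_, h.isModelCompletion⟩, fun ⟨_, h⟩ => h.deMorganCoherent⟩,
    ⟨fun h => ⟨⟨_, h.isModelCompletion.isModelCompanion⟩, h.amalgamation⟩,
      fun ⟨⟨_, h⟩, hT⟩ => (h.isModelCompletion hT).deMorganCoherent⟩,
    fun _ _ => ⟨fun h => h.stronglyInvariant, fun h =>
      h.deMorganAt CoherentLogic.provable_ecTheory (CoherentLogic.modelConsistent_ecTheory T)⟩⟩
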